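/- Let $k$ be a field, $n$ a positive integer, $q\in k^\times$, and put $\widehat q=q-q^{-1}$. Let $A=\mathcal O_q(M_n(k))$ be the $k$-algebra with generators $X_{ij}$ $(1\le i,j\le n)$ and relations $$X_{ij}X_{lj}=qX_{lj}X_{ij}\ (i<l),\qquad X_{ij}X_{im}=qX_{im}X_{ij}\ (j<m),$$ $$X_{ij}X_{lm}=X_{lm}X_{ij}\ (i<l,\ j>m),\qquad X_{ij}X_{lm}-X_{lm}X_{ij}=\widehat q\,X_{im}X_{lj}\ (i<l,\ j<m).$$ For $I=\{i_1<\dots<i_t\}$ and $J=\{j_1<\dots<j_t\}$ in $\{1,\dots,n\}$, let $$[I|J]=\sum_{\sigma\in S_t}(-q)^{\ell(\sigma)}X_{i_{\sigma(1)}j_1}\cdots X_{i_{\sigma(t)}j_t}$$ be the quantum minor, where $\ell(\sigma)$ is the length (number of inversions) of $\sigma$; thus $[\varnothing|\varnothing]=1$. Write $I\le J$ if $i_l\le j_l$ for all $l$, and $I<J$ if moreover $I\ne J$. For $S,T\subseteq\{1,\dots,n\}$ let $\ell(S;T)=|\{(s,t)\in S\times T: s>t\}|$. For $d\ge 1$ let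 $[d]_{-q}=\sum_{i=0}^{d-1}(-q)^{d-1-2i}$, and for index sets $I\ge J$ of cardinality $m$, $I=\{r_1<\dots<r_m\}$, let $\xi_q(I;J)=\prod_{l=1}^m[d_l]_{-q}$ with $d_l=|[1,r_l]\cap J|-l+1$ (an empty product is $1$). For $X,Y\subseteq\{1,\dots,n\}$ let $$\{X,Y\}^{<}=\{S\subseteq X\cup Y: X\cap Y\subseteq S,\ |S|=|X|,\ S<X\},$$ $$\{X,Y\}^{>}=\{T\subseteq X\cup Y: X\cap Y\subseteq T,\ |T|=|X|,\ T>X\}.$$ For $X\cap Y\subseteq S\subseteq X\cup Y$ let $S^\natural=S^\natural_{X,Y}=(X\cap Y)\sqcup\big((X\cup Y)\setminus S\big)$. For $S\in\{X,Y\}^<$ and $T\in\{X,Y\}^>$ let $$\mathcal L(S,X,Y)=\ell\big((S\setminus S^\natural)\cup(Y\setminus X);X\setminus S\big)-\ell\big((S\setminus S^\natural)\cup(Y\setminus X);S\setminus X\big),$$ $$\mathcal L^\natural(T,X,Y)=\ell\big((T^\natural\setminus T)\cup(X\setminus Y);T\setminus X\big)-\ell\big((T^\natural\setminus T)\cup(X\setminus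 Y);X\setminus T\big).$$ **Corollary 5.4.** Let $I,J,M,N\subseteq\{1,\dots,n\}$ with $|I|=|J|$ and $|M|=|N|$. Then $$q^{|J\cap N|}[I|J][M|N]+q^{|J\cap N|}\sum_{S\in\{J,N\}^<}\lambda_S\,[I|S][M|S^\natural] = q^{|I\cap M|}[M|N][I|J]+q^{|I\cap M|}\sum_{T\in\{I,M\}^>}\mu_T\,[T^\natural|N][T|J],$$ where $S^\natural=S^\natural_{J,N}$, $T^\natural=T^\natural_{I,M}$, and $$\lambda_S=\widehat q^{\,|J\setminus S|}(-q)^{\mathcal L(S,J,N)}\xi_q(J\setminus S;S\setminus J),\qquad \mu_T=\widehat q^{\,|T\setminus I|}(-q)^{\mathcal L^\natural(T,I,M)}\xi_q(T\setminus I;I\setminus T)$$ for $S\in\{J,N\}^<$ and $T\in\{I,M\}^>$. -/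

import Mathlib

open scoped BigOperators

namespace QMat

/-- The defining relations of the quantized coordinate ring of `n × n` matrices, on the free
algebra on symbols `X i j` (indices are `0, …, n - 1` rather than `1, …, n`). -/
inductive Rel (k : Type*) [Field k] (n : ℕ) (q : k) :
    FreeAlgebra k (Fin n × Fin n) → FreeAlgebra k (Fin n × Fin n) → Prop
  | col (i l j : Fin n) (hil : i < l) :
      Rel k n q (FreeAlgebra.ι k (i, j) * FreeAlgebra.ι k (l, j))
        (q • (FreeAlgebra.ι k (l, j) * FreeAlgebra.ι k (i, j)))
  | row (i j m : Fin n) (hjm : j < m) :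
      Rel k n q (FreeAlgebra.ι k (i, j) * FreeAlgebra.ι k (i, m))
        (q • (FreeAlgebra.ι k (i, m) * FreeAlgebra.ι k (i, j)))
  | comm (i l j m : Fin n) (hil : i < l) (hmj : m < j) :
      Rel k n q (FreeAlgebra.ι k (i, j) * FreeAlgebra.ι k (l, m))
        (FreeAlgebra.ι k (l, m) * FreeAlgebra.ι k (i, j))
  | cross (i l j m : Fin n) (hil : i < l) (hjm : j < m) :
      Rel k n q (FreeAlgebra.ι k (i, j) * FreeAlgebra.ι k (l, m)
          - FreeAlgebra.ι k (l, m) * FreeAlgebra.ι k (i, j))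
        ((q - q⁻¹) • (FreeAlgebra.ι k (i, m) * FreeAlgebra.ι k (l, j)))

/-- The standard single-parameter quantized coordinate ring `𝒪_q(M_n(k))`. -/
abbrev Oq (k : Type*) [Field k] (n : ℕ) (q : k) : Type _ := RingQuot (Rel k n q)

/-- The generator `X_{ij}` of `𝒪_q(M_n(k))`. -/
noncomputable def X {k : Type*} [Field k] {n : ℕ} (q : k) (i j : Fin n) : Oq k n q :=
  RingQuot.mkAlgHom k (Rel k n q) (FreeAlgebra.ι k (i, j))

/-- The length of a permutation: its number of inversions, which is its Coxeter length with
respect to the simple transpositions `(l, l + 1)`. -/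
def permLength {t : ℕ} (σ : Equiv.Perm (Fin t)) : ℕ :=
  (Finset.univ.filter fun p : Fin t × Fin t => p.1 < p.2 ∧ σ p.2 < σ p.1).card

/-- The quantum minor `[I | J]` with row set `I = {i₁ < ⋯ < i_t}` and column set
`J = {j₁ < ⋯ < j_t}`, namely
`∑_σ (-q)^{ℓ(σ)} X_{i_{σ(1)} j₁} X_{i_{σ(2)} j₂} ⋯ X_{i_{σ(t)} j_t}`.
It is only meant for index sets of equal cardinality (and is set to `0` otherwise). -/
noncomputable def minor {k : Type*} [Field k] {n : ℕ} (q : k) (I J : Finset (Fin n)) :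
    Oq k n q :=
  if h : J.card = I.card then
    ∑ σ : Equiv.Perm (Fin I.card),
      (-q) ^ permLength σ •
        (List.ofFn fun l : Fin I.card =>
          X q (I.orderEmbOfFin rfl (σ l)) (J.orderEmbOfFin h l)).prod
  else 0

/-- `ℓ(S; T)`, the number of pairs `(s, t) ∈ S × T` with `s > t`. -/
def ell {n : ℕ} (S T : Finset (Fin n)) : ℕ :=
  ((S ×ˢ T).filter fun p => p.2 < p.1).card

/-- The partial order on index sets of the same cardinality: `I ≤ J` iff `i_l ≤ j_l` for all `l`,
where `I = {i₁ < ⋯ < i_t}` and `J = {j₁ < ⋯ < j_t}`. -/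
def IndexLE {n : ℕ} (I J : Finset (Fin n)) : Prop :=
  ∃ h : J.card = I.card, ∀ l : Fin I.card, I.orderEmbOfFin rfl l ≤ J.orderEmbOfFin h l

instance {n : ℕ} (I J : Finset (Fin n)) : Decidable (IndexLE I J) :=
  inferInstanceAs (Decidable (∃ h : J.card = I.card,
    ∀ l : Fin I.card, I.orderEmbOfFin rfl l ≤ J.orderEmbOfFin h l))

/-- The `(-q)`-integer `[d]_{-q} = (-q)^{d-1} + (-q)^{d-3} + ⋯ + (-q)^{-(d-1)}`. -/
def negQInt {k : Type*} [Field k] (q : k) (d : ℕ) : k :=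
  ∑ i ∈ Finset.range d, (-q) ^ ((d : ℤ) - 1 - 2 * (i : ℤ))

/-- The scalar `ξ_q(I; J)` for index sets `I ≥ J`. If `I = {r₁ < ⋯ < r_m}` and
`d_l = |[1, r_l] ∩ J| - l + 1` then `ξ_q(I; J) = [d₁]_{-q} ⋯ [d_m]_{-q}`. In the code `l` starts
at `0`, whence `d = |{x ∈ J | x ≤ r_l}| - l`, which is at least `1` when `I ≥ J`. -/
def xi {k : Type*} [Field k] {n : ℕ} (q : k) (I J : Finset (Fin n)) : k :=
  ∏ l : Fin I.card,
    negQInt q ((J.filter fun x => x ≤ I.orderEmbOfFin rfl l).card - (l : ℕ))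

/-- The index sets `S ⊆ X ∪ Y` with `X ∩ Y ⊆ S`, `|S| = |X|` and `S < X`. -/
def lsInd {n : ℕ} (X Y : Finset (Fin n)) : Finset (Finset (Fin n)) :=
  (X ∪ Y).powerset.filter fun S =>
    X ∩ Y ⊆ S ∧ S.card = X.card ∧ (IndexLE S X ∧ S ≠ X)

/-- The index sets `T ⊆ X ∪ Y` with `X ∩ Y ⊆ T`, `|T| = |X|` and `T > X`. -/
def grInd {n : ℕ} (X Y : Finset (Fin n)) : Finset (Finset (Fin n)) :=
  (X ∪ Y).powerset.filter fun T =>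
    X ∩ Y ⊆ T ∧ T.card = X.card ∧ (IndexLE X T ∧ T ≠ X)

/-- `S♮ = (X ∩ Y) ⊔ ((X ∪ Y) \ S)`, for `X ∩ Y ⊆ S ⊆ X ∪ Y`. -/
def natural {n : ℕ} (S X Y : Finset (Fin n)) : Finset (Fin n) :=
  (X ∩ Y) ∪ ((X ∪ Y) \ S)

/-- The exponent `𝓛(S, X, Y)`. -/
def expL {n : ℕ} (S X Y : Finset (Fin n)) : ℤ :=
  (ell ((S \ natural S X Y) ∪ (Y \ X)) (X \ S) : ℤ)
    - (ell ((S \ natural S X Y) ∪ (Y \ X)) (S \ X) : ℤ)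

/-- The exponent `𝓛♮(T, X, Y)`. -/
def expLNat {n : ℕ} (T X Y : Finset (Fin n)) : ℤ :=
  (ell ((natural T X Y \ T) ∪ (X \ Y)) (T \ X) : ℤ)
    - (ell ((natural T X Y \ T) ∪ (X \ Y)) (X \ T) : ℤ)

/-- `(q - q⁻¹)^{|X \ S|} (-q)^{𝓛(S, X, Y)} ξ_q(X \ S; S \ X)`, the coefficient attached to an
index set `S < X`. -/
def lam {k : Type*} [Field k] {n : ℕ} (q : k) (S X Y : Finset (Fin n)) : k :=
  (q - q⁻¹) ^ (X \ S).card * (-q) ^ expL S X Y * xi q (X \ S) (S \ X)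

/-- `(q - q⁻¹)^{|T \ X|} (-q)^{𝓛♮(T, X, Y)} ξ_q(T \ X; X \ T)`, the coefficient attached to an
index set `T > X`. -/
def mu {k : Type*} [Field k] {n : ℕ} (q : k) (T X Y : Finset (Fin n)) : k :=
  (q - q⁻¹) ^ (T \ X).card * (-q) ^ expLNat T X Y * xi q (T \ X) (X \ T)

end QMat

/-! Let `x`, `y` be two quantum exterior families linked by the relations `QGrass`. A product y_N
x_J can be reordered into a combination of the monomials x_S y_{S♮}, with explicit scalars `weight q
n J N S` (`QGrass.word_mul_word`). The coaction x_j ↦ ∑ X_{ij} ⊗ x_i, applied to both families,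
preserves these relations (`QGrass.coact`), and the coefficients of the coacted ordered words are
quantum minors (`QExt.word_coact`).

The coefficient of x_I y_M in the coacted y_N x_J can therefore be computed in two ways. Reordering
the coacted words and then expanding gives ∑ over S of weight(J, N; S) [I|S][M|S♮]. Expanding first
and then reordering gives ∑ over T, T' of weight(T, T'; I) [T'|N][T|J]. Equality of the two
(`sum_weight_smul_minor_mul_minor`) is the theorem once the weights are identified with λ and μ
(`weight_eq_lam`, `mu_eq_lam`). Reading off coefficients requires the monomials x_I y_M to be
independent in some model, which `exists_fock` constructs.

The weight is a product of local factors, one per index p, depending only on the membership of p in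
J, N, S and on the excess of S over J below p. The reordering formula follows by adding indices in
increasing order; its scalar content is the identity `sum_weight_erase`. -/

open scoped BigOperators TensorProduct

namespace QMat

/-! ### Ordered words in quantum exterior families and their elementary commutations. -/

section Words

variable {ι R : Type*} [LinearOrder ι]

/-- The product of the `x i`, `i ∈ S`, in increasing order of `i`. -/
def word [Monoid R] (x : ι → R) (S : Finset ι) : R :=
  ((S.sort (· ≤ ·)).map x).prod

@[simp] lemma word_empty [Monoid R] (x : ι → R) : word x ∅ = 1 := by
  simp [word]

lemma word_insert_min [Monoid R] (x : ι → R) {a : ι} {S : Finset ι} (h : ∀ b ∈ S, a < b) :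
    word x (insert a S) = x a * word x S := by
  have ha : a ∉ S := fun h' => lt_irrefl _ (h a h')
  rw [word, Finset.sort_insert (r := (· ≤ ·)) (fun b hb => (h b hb).le) ha]
  simp [word]

lemma sort_insert_max {a : ι} {S : Finset ι} (h : ∀ b ∈ S, b < a) :
    (insert a S).sort (· ≤ ·) = S.sort (· ≤ ·) ++ [a] := by
  have ha : a ∉ S := fun h' => lt_irrefl _ (h a h')
  refine List.Perm.eq_of_pairwise (le := (· ≤ ·)) (fun _ _ _ _ => le_antisymm)
    (Finset.pairwise_sort _ _) ?_ ?_
  · rw [List.pairwise_append]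
    refine ⟨Finset.pairwise_sort _ _, by simp, ?_⟩
    intro b hb c hc
    simp only [List.mem_singleton] at hc
    subst hc
    exact (h b (by simpa using hb)).le
  · rw [List.perm_ext_iff_of_nodup (Finset.sort_nodup _ _)]
    · intro b
      simp [or_comm]
    · rw [List.nodup_append]
      refine ⟨Finset.sort_nodup _ _, by simp, ?_⟩
      intro b hb c hc
      simp only [List.mem_singleton] at hc
      subst hc
      exact (h b (by simpa using hb)).ne

lemma word_insert_max [Monoid R] (x : ι → R) {a : ι} {S : Finset ι} (h : ∀ b ∈ S, b < a) :
    word x (insert a S) = word x S * x a := by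
  simp [word, sort_insert_max h]

/-- The defining relations of a quantum exterior algebra. -/
structure QExt {k : Type*} [Field k] [Ring R] [Algebra k R] (q : k) (x : ι → R) : Prop where
  sq (i : ι) : x i * x i = 0
  swap {i j : ι} (h : i < j) : x j * x i = (-q) • (x i * x j)

/-- The relations between two families of generators of a quantum exterior algebra on a
two-row array. -/
structure QGrass {k : Type*} [Field k] [Ring R] [Algebra k R] (q : k) (x y : ι → R) : Prop where
  left : QExt q x
  right : QExt q y
  diag (i : ι) : y i * x i = q • (x i * y i)
  comm {i j : ι} (h : i < j) : y j * x i = x i * y j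
  cross {i j : ι} (h : i < j) : y i * x j = x j * y i + (q - q⁻¹) • (x i * y j)

variable {k : Type*} [Field k] [Ring R] [Algebra k R] {q : k} {x y : ι → R}

lemma QExt.mul_word (hx : QExt q x) (a : ι) (S : Finset ι) :
    x a * word x S = if a ∈ S then 0 else
      (-q) ^ (S.filter (· < a)).card • word x (insert a S) := by
  induction S using Finset.induction_on_min with
  | empty => simp [word]
  | insert m T hm ih =>
    have hmT : m ∉ T := fun h => lt_irrefl _ (hm m h)
    rw [word_insert_min x hm]
    rcases lt_trichotomy a m with h | h | h
    · have haT : ∀ b ∈ insert m T, a < b := by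
        intro b hb
        rcases Finset.mem_insert.1 hb with rfl | hb
        · exact h
        · exact h.trans (hm b hb)
      have h1 : a ∉ insert m T := fun h' => lt_irrefl _ (haT a h')
      have h2 : (insert m T).filter (· < a) = ∅ :=
        Finset.filter_eq_empty_iff.2 fun b hb => (haT b hb).le.not_gt
      rw [if_neg h1, h2, word_insert_min x haT, word_insert_min x hm]
      simp
    · subst h
      simp [← mul_assoc, hx.sq]
    · rw [← mul_assoc, hx.swap h, smul_mul_assoc, mul_assoc, ih]
      by_cases haT : a ∈ T
      · simp [haT]
      · have h1 : a ∉ insert m T := by simp [haT, h.ne']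
        have h3 : ∀ b ∈ insert a T, m < b := by
          intro b hb
          rcases Finset.mem_insert.1 hb with rfl | hb
          · exact h
          · exact hm b hb
        rw [if_neg haT, if_neg h1, Finset.filter_insert, if_pos h,
          Finset.card_insert_of_notMem (by simp [hmT]), Finset.insert_comm a m T,
          word_insert_min x h3, mul_smul_comm, smul_smul, pow_succ']

lemma QExt.word_mul (hx : QExt q x) (a : ι) (S : Finset ι) :
    word x S * x a = if a ∈ S then 0 else
      (-q) ^ (S.filter (a < ·)).card • word x (insert a S) := by
  induction S using Finset.induction_on_max with
  | empty => simp [word]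
  | insert m T hm ih =>
    have hmT : m ∉ T := fun h => lt_irrefl _ (hm m h)
    rw [word_insert_max x hm]
    rcases lt_trichotomy m a with h | h | h
    · have haT : ∀ b ∈ insert m T, b < a := by
        intro b hb
        rcases Finset.mem_insert.1 hb with rfl | hb
        · exact h
        · exact (hm b hb).trans h
      have h1 : a ∉ insert m T := fun h' => lt_irrefl _ (haT a h')
      have h2 : (insert m T).filter (a < ·) = ∅ :=
        Finset.filter_eq_empty_iff.2 fun b hb => (haT b hb).le.not_gt
      rw [if_neg h1, h2, word_insert_max x haT, word_insert_max x hm]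
      simp
    · subst h
      simp [mul_assoc, hx.sq]
    · rw [mul_assoc, hx.swap h, mul_smul_comm, ← mul_assoc, ih]
      by_cases haT : a ∈ T
      · simp [haT]
      · have h1 : a ∉ insert m T := by simp [haT, h.ne]
        have h3 : ∀ b ∈ insert a T, b < m := by
          intro b hb
          rcases Finset.mem_insert.1 hb with rfl | hb
          · exact h
          · exact hm b hb
        rw [if_neg haT, if_neg h1, Finset.filter_insert, if_pos h,
          Finset.card_insert_of_notMem (by simp [hmT]), Finset.insert_comm a m T,
          word_insert_max x h3, smul_mul_assoc, smul_smul, pow_succ']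

lemma QGrass.mul_word_comm (h : QGrass q x y) {a : ι} {J : Finset ι} (hJ : ∀ j ∈ J, j < a) :
    y a * word x J = word x J * y a := by
  induction J using Finset.induction_on_max with
  | empty => simp
  | insert m T hm ih =>
    rw [word_insert_max x hm, ← mul_assoc, ih fun j hj => hJ j (Finset.mem_insert_of_mem hj),
      mul_assoc, h.comm (hJ m (Finset.mem_insert_self _ _)), mul_assoc]

/-- Since `a` lies beyond `M`, either x_a passes through unchanged, or one index `m` of `M` hops
from the y-word to the front as x_m while `a` joins the y-word. The induction uses the hypothesis at
both `a` and the maximum of `M`, so `a` is generalized. -/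
lemma QGrass.word_mul_hop (hq : q ≠ 0) (h : QGrass q x y) {a : ι} {M : Finset ι}
    (hM : ∀ m ∈ M, m < a) :
    word y M * x a = x a * word y M + ∑ m ∈ M, ((q - q⁻¹) * (-q)⁻¹ ^ (M.filter (m < ·)).card) •
      (x m * word y (M.erase m) * y a) := by
  induction M using Finset.induction_on_max generalizing a with
  | empty => simp
  | insert p T hp ih =>
    have hpT : p ∉ T := fun h => lt_irrefl _ (hp p h)
    have hpa : p < a := hM p (Finset.mem_insert_self _ _)
    have e1 := ih hp
    have e2 := ih fun m hm => hM m (Finset.mem_insert_of_mem hm)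
    have hnp : (insert p T).filter (p < ·) = ∅ := by
      refine Finset.filter_eq_empty_iff.2 fun b hb => ?_
      rcases Finset.mem_insert.1 hb with rfl | hb
      · exact lt_irrefl _
      · exact (hp b hb).le.not_gt
    have hsum : ∑ m ∈ T, ((q - q⁻¹) * (-q)⁻¹ ^ ((insert p T).filter (m < ·)).card) •
        (x m * word y ((insert p T).erase m) * y a) =
        ∑ m ∈ T, ((-q)⁻¹ * ((q - q⁻¹) * (-q)⁻¹ ^ (T.filter (m < ·)).card)) •
        (x m * word y (T.erase m) * y p * y a) := by
      refine Finset.sum_congr rfl fun m hm => ?_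
      have hmp := hp m hm
      rw [Finset.filter_insert, if_pos hmp, Finset.card_insert_of_notMem (by simp [hpT]),
        Finset.erase_insert_of_ne hmp.ne',
        word_insert_max y fun b hb => hp b (Finset.mem_of_mem_erase hb), pow_succ]
      congr 1
      · ring
      · noncomm_ring
    rw [Finset.sum_insert hpT, hsum, hnp, Finset.erase_insert hpT, word_insert_max y hp,
      mul_assoc, h.cross hpa, mul_add, ← mul_assoc, e2, mul_smul_comm, ← mul_assoc, e1]
    -- An index `m` below `p` reaches the front in two ways: by exchange with `a` directly, costing
    -- -q to sort y_a y_p, or by exchange with the x_p created by `p` hopping first, costing q -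
    -- q⁻¹. This identity adds the two costs.
    have hc : (-q)⁻¹ = -q + (q - q⁻¹) := by field_simp; ring
    simp only [add_mul, Finset.sum_mul, smul_add, Finset.smul_sum, Finset.card_empty, pow_zero,
      mul_one]
    have hy : ∀ m, x m * word y (T.erase m) * y a * y p =
        (-q) • (x m * word y (T.erase m) * y p * y a) := by
      intro m
      rw [mul_assoc, h.right.swap hpa, mul_smul_comm]
      simp only [mul_assoc]
    simp only [smul_mul_assoc, hy]
    have : ∀ m ∈ T, ((-q)⁻¹ * ((q - q⁻¹) * (-q)⁻¹ ^ (T.filter (m < ·)).card)) •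
        (x m * word y (T.erase m) * y p * y a) =
        ((q - q⁻¹) * (-q)⁻¹ ^ (T.filter (m < ·)).card) • (-q) •
          (x m * word y (T.erase m) * y p * y a) +
        (q - q⁻¹) • ((q - q⁻¹) * (-q)⁻¹ ^ (T.filter (m < ·)).card) •
          (x m * word y (T.erase m) * y p * y a) := by
      intro m _
      rw [smul_smul, smul_smul, ← add_smul]
      congr 1
      generalize (q - q⁻¹) * (-q)⁻¹ ^ (T.filter (m < ·)).card = c
      rw [hc]; ring
    rw [Finset.sum_congr rfl this, Finset.sum_add_distrib]
    simp only [mul_assoc]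
    abel

end Words

/-! ### The reordering coefficients as products of local weights, and their recursion. -/

section Weights

variable {k : Type*} [Field k] {n : ℕ}

/-- The elements of `S` among the first `c` indices. -/
def cut (c : ℕ) (S : Finset (Fin n)) : Finset (Fin n) := S.filter fun p => p.val < c

@[simp] lemma mem_cut {c : ℕ} {S : Finset (Fin n)} {p : Fin n} :
    p ∈ cut c S ↔ p ∈ S ∧ p.val < c := by
  simp [cut]

@[simp] lemma cut_zero (S : Finset (Fin n)) : cut 0 S = ∅ := by
  ext; simp

lemma cut_self (S : Finset (Fin n)) : cut n S = S := by
  ext; simp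

lemma cut_succ_of_mem {p : Fin n} {S : Finset (Fin n)} (h : p ∈ S) :
    cut (p.val + 1) S = insert p (cut p.val S) := by
  ext i
  simp only [mem_cut, Finset.mem_insert, Fin.ext_iff]
  constructor
  · rintro ⟨hi, hlt⟩
    rcases Nat.lt_succ_iff_lt_or_eq.1 hlt with h' | h'
    · exact .inr ⟨hi, h'⟩
    · exact .inl h'
  · rintro (h' | ⟨hi, hlt⟩)
    · have : i = p := Fin.ext h'
      subst this
      exact ⟨h, Nat.lt_succ_self _⟩
    · exact ⟨hi, hlt.trans (Nat.lt_succ_self _)⟩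

lemma cut_succ_of_notMem {p : Fin n} {S : Finset (Fin n)} (h : p ∉ S) :
    cut (p.val + 1) S = cut p.val S := by
  ext i
  simp only [mem_cut]
  refine and_congr_right fun hi => ?_
  have : i.val ≠ p.val := fun h' => h (Fin.ext h' ▸ hi)
  omega

lemma notMem_cut (p : Fin n) (S : Finset (Fin n)) : p ∉ cut p.val S := by
  simp

lemma sum_cut_succ {M : Type*} [AddCommMonoid M] (p : Fin n) (S : Finset (Fin n))
    (f : Fin n → M) :
    ∑ m ∈ cut (p.val + 1) S, f m = (∑ m ∈ cut p.val S, f m) + if p ∈ S then f p else 0 := by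
  by_cases h : p ∈ S
  · rw [cut_succ_of_mem h, Finset.sum_insert (notMem_cut p S), if_pos h, add_comm]
  · rw [cut_succ_of_notMem h, if_neg h, add_zero]

/-- The excess of `S` over `J` among the first `c` indices. -/
def height (c : ℕ) (J S : Finset (Fin n)) : ℤ := ((cut c S).card : ℤ) - (cut c J).card

lemma card_cut_succ (p : Fin n) (S : Finset (Fin n)) :
    (cut (p.val + 1) S).card = (cut p.val S).card + if p ∈ S then 1 else 0 := by
  by_cases h : p ∈ S
  · rw [cut_succ_of_mem h, Finset.card_insert_of_notMem (notMem_cut p S), if_pos h]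
  · rw [cut_succ_of_notMem h, if_neg h, add_zero]

lemma height_succ (p : Fin n) (J S : Finset (Fin n)) :
    height (p.val + 1) J S =
      height p.val J S + (if p ∈ S then 1 else 0) - (if p ∈ J then 1 else 0) := by
  simp only [height, card_cut_succ]
  push_cast
  ring

/-- The contribution of a single index to the coefficient of `x_S y_{S♮}` in `y_N x_J`,
according to its membership in `J`, `N` and `S`. -/
def localWeight (q : k) (inJ inN inS : Prop) [Decidable inJ] [Decidable inN] [Decidable inS]
    (h : ℤ) : k :=
  if inJ then
    if inN then (if inS then q else 0) else (if inS then (-q) ^ (-h) else negQInt q h.toNat)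
  else
    if inN then (if inS then (q - q⁻¹) * (-q) ^ (-h) else (-q) ^ (-h)) else (if inS then 0 else 1)

/-- The product of the local weights of the first `c` indices. -/
def weight (q : k) (c : ℕ) (J N S : Finset (Fin n)) : k :=
  ∏ p ∈ cut c Finset.univ, localWeight q (p ∈ J) (p ∈ N) (p ∈ S) (height p.val J S)

lemma weight_zero (q : k) (J N S : Finset (Fin n)) : weight q 0 J N S = 1 := by
  simp [weight]

lemma weight_succ (q : k) (p : Fin n) (J N S : Finset (Fin n)) :
    weight q (p.val + 1) J N S = weight q p.val J N S *
      localWeight q (p ∈ J) (p ∈ N) (p ∈ S) (height p.val J S) := by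
  rw [weight, cut_succ_of_mem (Finset.mem_univ p), Finset.prod_insert (notMem_cut p _), mul_comm]
  rfl

lemma weight_congr (q : k) {c : ℕ} (J N : Finset (Fin n)) {S S' : Finset (Fin n)}
    (h : cut c S = cut c S') : weight q c J N S = weight q c J N S' := by
  have hd : ∀ d ≤ c, cut d S = cut d S' := by
    intro d hd
    ext i
    have := Finset.ext_iff.1 h i
    simp only [mem_cut] at this ⊢
    constructor
    · rintro ⟨hi, hlt⟩
      exact ⟨(this.1 ⟨hi, by omega⟩).1, hlt⟩
    · rintro ⟨hi, hlt⟩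
      exact ⟨(this.2 ⟨hi, by omega⟩).1, hlt⟩
  refine Finset.prod_congr rfl fun p hp => ?_
  have hpc : p.val < c := (mem_cut.1 hp).2
  have hmem : p ∈ S ↔ p ∈ S' := by
    have := Finset.ext_iff.1 h p
    simpa [hpc] using this
  have hh : height p.val J S = height p.val J S' := by
    rw [height, height, hd _ hpc.le]
  simp only [hh, localWeight, hmem]

@[simp] lemma negQInt_zero (q : k) : negQInt q 0 = 0 := by simp [negQInt]

@[simp] lemma negQInt_one (q : k) : negQInt q 1 = 1 := by simp [negQInt]

lemma negQInt_succ {q : k} (hq : q ≠ 0) (d : ℕ) :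
    negQInt q (d + 1) = (-q) * negQInt q d + (-q) ^ (-(d : ℤ)) := by
  have hq' : -q ≠ 0 := neg_ne_zero.2 hq
  rw [negQInt, Finset.sum_range_succ, negQInt, Finset.mul_sum]
  congr 1
  · refine Finset.sum_congr rfl fun i _ => ?_
    rw [← zpow_one_add₀ hq']
    congr 1
    push_cast
    ring
  · congr 1
    push_cast
    ring

/-- The height starts at 0 and drops by at most 1 per index, so to become negative it must step from
0 to -1 at some index of `J` outside `S`. The local factor there is 0, either outright or as
`negQInt q 0`, and a vanishing factor persists in all longer products. -/
lemma weight_eq_zero_of_height_neg (q : k) {J N S : Finset (Fin n)} {c d : ℕ} (hcd : c ≤ d)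
    (hd : d ≤ n) (h : height c J S < 0) : weight q d J N S = 0 := by
  have key : ∀ c ≤ n, height c J S < 0 → weight q c J N S = 0 := by
    intro c
    induction c with
    | zero => intro _ h; simp [height] at h
    | succ c ih =>
      intro hc h
      obtain ⟨p, rfl⟩ : ∃ p : Fin n, p.val = c := ⟨⟨c, hc⟩, rfl⟩
      rw [weight_succ]
      by_cases h0 : height p.val J S < 0
      · rw [ih p.2.le h0, zero_mul]
      · rw [height_succ] at h
        have hJ : p ∈ J := by
          by_contra hJ
          rw [if_neg hJ] at h
          split_ifs at h <;> omega
        have hS : p ∉ S := by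
          intro hS
          rw [if_pos hJ, if_pos hS] at h
          omega
        rw [if_pos hJ, if_neg hS] at h
        have h0' : height p.val J S = 0 := by omega
        simp [localWeight, hJ, hS, h0']
  induction d, hcd using Nat.le_induction with
  | base => exact key c hd h
  | succ d hcd ih =>
    obtain ⟨p, rfl⟩ : ∃ p : Fin n, p.val = d := ⟨⟨d, hd⟩, rfl⟩
    rw [weight_succ, ih p.2.le, zero_mul]

lemma mem_natural {S J N : Finset (Fin n)} {p : Fin n} :
    p ∈ natural S J N ↔ (p ∈ J ∧ p ∈ N) ∨ ((p ∈ J ∨ p ∈ N) ∧ p ∉ S) := by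
  simp [natural]

/-- The exponent picked up when the index `m` is moved into place in `x_T`
and out of place in `y_{T'}`. -/
def hopExp (c : ℕ) (T T' : Finset (Fin n)) (m : Fin n) : ℤ :=
  (((cut c T).filter (m < ·)).card : ℤ) - ((cut c T').filter (m < ·)).card

lemma card_filter_cut_succ {p m : Fin n} (h : m < p) (S : Finset (Fin n)) :
    ((cut (p.val + 1) S).filter (m < ·)).card =
      ((cut p.val S).filter (m < ·)).card + if p ∈ S then 1 else 0 := by
  by_cases hp : p ∈ S
  · rw [cut_succ_of_mem hp, Finset.filter_insert, if_pos h,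
      Finset.card_insert_of_notMem (by simp), if_pos hp]
  · rw [cut_succ_of_notMem hp, if_neg hp, add_zero]

lemma hopExp_succ {p m : Fin n} (h : m < p) (T T' : Finset (Fin n)) :
    hopExp (p.val + 1) T T' m =
      hopExp p.val T T' m + ((if p ∈ T then 1 else 0) - (if p ∈ T' then 1 else 0)) := by
  simp only [hopExp, card_filter_cut_succ h]
  push_cast
  ring

lemma hopExp_succ_self (p : Fin n) (T T' : Finset (Fin n)) : hopExp (p.val + 1) T T' p = 0 := by
  have : ∀ S : Finset (Fin n), (cut (p.val + 1) S).filter (p < ·) = ∅ := by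
    intro S
    refine Finset.filter_eq_empty_iff.2 fun b hb => ?_
    have := (mem_cut.1 hb).2
    rw [Fin.lt_def]
    omega
  simp [hopExp, this]

lemma height_erase {c : ℕ} {J T : Finset (Fin n)} {m : Fin n} (hm : m ∈ cut c T) :
    height c J (T.erase m) = height c J T - 1 := by
  have : cut c (T.erase m) = (cut c T).erase m := by
    ext i; simp [and_assoc]
  rw [height, height, this, Finset.card_erase_of_mem hm,
    Nat.cast_sub (Finset.card_pos.2 ⟨m, hm⟩)]
  push_cast
  ring

/-- This is the scalar identity behind reordering: it adds up all the ways of obtaining `T` by a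
single hop. Only height 1 is needed later, where the right side is just the weight of `T`, but the
induction on `c` passes through arbitrary heights. -/
lemma sum_weight_erase {q : k} (hq : q ≠ 0) {J N T : Finset (Fin n)} (hT : T ⊆ J ∪ N) {c : ℕ}
    (hc : c ≤ n) :
    ∑ m ∈ cut c T, (q - q⁻¹) * (-q) ^ hopExp c T (natural T J N) m * weight q c J N (T.erase m) =
      (-q) ^ (height c J T - 1) * negQInt q (height c J T).toNat * weight q c J N T := by
  have hq' : -q ≠ 0 := neg_ne_zero.2 hq
  induction c with
  | zero => simp [height]
  | succ c ih =>
    obtain ⟨p, rfl⟩ : ∃ p : Fin n, p.val = c := ⟨⟨c, hc⟩, rfl⟩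
    specialize ih p.2.le
    set T' := natural T J N with hT'
    set h := height p.val J T with hh
    -- Erasing some `m` below `p` lowers the height at `p` by one, so all these terms share the
    -- local factor taken at `h - 1`, and the induction hypothesis applies to what remains.
    have hsum : ∑ m ∈ cut p.val T, (q - q⁻¹) * (-q) ^ hopExp (p.val + 1) T T' m *
          weight q (p.val + 1) J N (T.erase m) =
        (-q) ^ (((if p ∈ T then 1 else 0) - (if p ∈ T' then 1 else 0) : ℤ)) *
          localWeight q (p ∈ J) (p ∈ N) (p ∈ T) (h - 1) *
          ((-q) ^ (h - 1) * negQInt q h.toNat * weight q p.val J N T) := by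
      rw [← ih, Finset.mul_sum]
      refine Finset.sum_congr rfl fun m hm => ?_
      have hmp : m < p := (mem_cut.1 hm).2
      have hpm : p ∈ T.erase m ↔ p ∈ T := by simp [hmp.ne']
      rw [hopExp_succ hmp, weight_succ, height_erase hm, zpow_add₀ hq']
      simp only [hpm]
      ring
    have hlast : weight q p.val J N (T.erase p) = weight q p.val J N T :=
      weight_congr q J N (by ext i; simp only [mem_cut, Finset.mem_erase]; grind)
    have hlast' : height p.val J (T.erase p) = h := by
      rw [hh, height, height]
      congr 3
      ext i; simp only [mem_cut, Finset.mem_erase]; grind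
    rw [sum_cut_succ, hsum, hopExp_succ_self, weight_succ, weight_succ, hlast, hlast', height_succ,
      ← hh]
    generalize hw : weight q p.val J N T = w
    -- The recursion for `negQInt` fails at negative `h`, where `toNat` truncates. The factor `w`
    -- repairs it, because the weight vanishes there.
    have hbr : w * negQInt q (h + 1).toNat = w * ((-q) * negQInt q h.toNat + (-q) ^ (-h)) := by
      rcases lt_or_ge h 0 with h0 | h0
      · rw [← hw, weight_eq_zero_of_height_neg q le_rfl p.2.le h0]
        simp
      · obtain ⟨d, hd⟩ := Int.eq_ofNat_of_zero_le h0
        rw [hd, ← Nat.cast_succ, Int.toNat_natCast, Int.toNat_natCast, negQInt_succ hq]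
    have hpT' : p ∈ T' ↔ (p ∈ J ∧ p ∈ N) ∨ ((p ∈ J ∨ p ∈ N) ∧ p ∉ T) := mem_natural
    have hpT : p ∈ T → p ∈ J ∨ p ∈ N := fun hp => by simpa using hT hp
    simp only [hpT']
    have e1 : (-q) ^ (h - 1) = (-q) ^ h * (-q)⁻¹ := by rw [zpow_sub_one₀ hq']
    have e2 : (-q) ^ (1 - h) = ((-q) ^ h)⁻¹ * (-q) := by
      rw [zpow_sub₀ hq', zpow_one]; field_simp
    have e3 : (-q) ^ (-h) = ((-q) ^ h)⁻¹ := zpow_neg _ _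
    have e4 : (-q) ^ (h - 1 - 1) = (-q) ^ h * (-q)⁻¹ * (-q)⁻¹ := by
      rw [zpow_sub_one₀ hq', zpow_sub_one₀ hq']
    have hz : (-q) ^ h ≠ 0 := zpow_ne_zero _ hq'
    by_cases hJ : p ∈ J <;> by_cases hN : p ∈ N <;> by_cases hS : p ∈ T
    all_goals simp [hJ, hN, hS, localWeight] at hpT ⊢
    all_goals simp only [e1, e2, e3, e4] at hbr ⊢
    all_goals
      generalize (-q) ^ h = z at *
      generalize negQInt q (h + 1).toNat = b₁ at *
      generalize negQInt q h.toNat = b at *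
    · ring
    · field_simp
      ring
    · field_simp
    · have : z * b₁ * (w * ((q - q⁻¹) * z⁻¹)) = (q - q⁻¹) * (w * b₁) := by
        field_simp
      rw [this, hbr]
      field_simp
    · field_simp

end Weights

/-! ### The reordering formula for y_N x_J. -/

section Reorder

/-- Reindexing by T = S ∪ {m}, which collects all the hops that end at the same set. -/
lemma sum_powerset_sdiff {ι M : Type*} [DecidableEq ι] [AddCommMonoid M] (P : Finset ι)
    (f : Finset ι → ι → M) :
    ∑ S ∈ P.powerset, ∑ m ∈ P \ S, f S m = ∑ T ∈ P.powerset, ∑ m ∈ T, f (T.erase m) m := by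
  rw [Finset.sum_sigma', Finset.sum_sigma']
  refine Finset.sum_bij' (fun a _ => ⟨insert a.2 a.1, a.2⟩) (fun a _ => ⟨a.1.erase a.2, a.2⟩)
    ?_ ?_ ?_ ?_ ?_
  · rintro ⟨S, m⟩ h
    simp only [Finset.mem_sigma, Finset.mem_powerset, Finset.mem_sdiff] at h ⊢
    exact ⟨Finset.insert_subset h.2.1 h.1, Finset.mem_insert_self _ _⟩
  · rintro ⟨S, m⟩ h
    simp only [Finset.mem_sigma, Finset.mem_powerset, Finset.mem_sdiff] at h ⊢
    exact ⟨(Finset.erase_subset _ _).trans h.1, h.1 h.2, Finset.notMem_erase _ _⟩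
  · rintro ⟨S, m⟩ h
    simp only [Finset.mem_sigma, Finset.mem_powerset, Finset.mem_sdiff] at h
    simp [Finset.erase_insert h.2.2]
  · rintro ⟨S, m⟩ h
    simp only [Finset.mem_sigma, Finset.mem_powerset] at h
    simp [Finset.insert_erase h.2]
  · rintro ⟨S, m⟩ h
    simp only [Finset.mem_sigma, Finset.mem_powerset, Finset.mem_sdiff] at h
    simp [Finset.erase_insert h.2.2]

variable {k : Type*} [Field k] {n : ℕ} {R : Type*} [Ring R] [Algebra k R] {q : k}
  {x y : Fin n → R}

lemma cut_of_subset {c : ℕ} {S U : Finset (Fin n)} (h : S ⊆ cut c U) : cut c S = S := by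
  ext i
  simp only [mem_cut, and_iff_left_iff_imp]
  exact fun hi => (mem_cut.1 (h hi)).2

lemma cut_natural (c : ℕ) (S J N : Finset (Fin n)) :
    cut c (natural S J N) = natural S (cut c J) (cut c N) := by
  ext i
  simp only [mem_cut, mem_natural]
  tauto

lemma weight_eq_zero_of_mem (q : k) {c : ℕ} {J N S : Finset (Fin n)} {m : Fin n} (hc : m.val < c)
    (hJ : m ∈ J) (hN : m ∈ N) (hS : m ∉ S) : weight q c J N S = 0 :=
  Finset.prod_eq_zero (i := m) (by simp [hc]) (by simp [localWeight, hJ, hN, hS])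

/-- By `QGrass.word_mul_hop`, each term either lets x_p through or moves one index `m` into the
x-word. Grouped by the enlarged set `T`, which has height 1, the hop coefficients add up to the
weight of `T` by `sum_weight_erase`. -/
lemma QGrass.word_mul_mul (hq : q ≠ 0) (h : QGrass q x y) (J N : Finset (Fin n)) (p : Fin n)
    (j : ℕ) (hj : (cut p.val J).card = j) :
    (∑ S ∈ (cut p.val (J ∪ N)).powerset, if S.card = j then
      weight q p.val J N S • (word x S * word y (natural S (cut p.val J) (cut p.val N))) else 0) *
        x p =
    (∑ S ∈ (cut p.val (J ∪ N)).powerset, if S.card = j then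
      weight q p.val J N S • (word x S * x p * word y (natural S (cut p.val J) (cut p.val N)))
        else 0) +
    ∑ S ∈ (cut p.val (J ∪ N)).powerset, if S.card = j + 1 then
      weight q p.val J N S • (word x S * word y (natural S (cut p.val J) (cut p.val N)) * y p)
        else 0 := by
  have hq' : -q ≠ 0 := neg_ne_zero.2 hq
  set P := cut p.val (J ∪ N) with hP
  have hlt : ∀ S, ∀ m ∈ natural S (cut p.val J) (cut p.val N), m < p := by
    intro S m hm
    rw [← cut_natural, mem_cut] at hm
    exact hm.2
  have step : ∀ S ∈ P.powerset, (if S.card = j then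
      weight q p.val J N S • (word x S * word y (natural S (cut p.val J) (cut p.val N))) else 0) *
        x p = (if S.card = j then
      weight q p.val J N S • (word x S * x p * word y (natural S (cut p.val J) (cut p.val N)))
        else 0) + ∑ m ∈ P \ S, if S.card = j then (weight q p.val J N S * ((q - q⁻¹) *
          (-q)⁻¹ ^ ((natural S (cut p.val J) (cut p.val N)).filter (m < ·)).card *
          (-q) ^ (S.filter (m < ·)).card)) •
          (word x (insert m S) * word y ((natural S (cut p.val J) (cut p.val N)).erase m) * y p)
          else 0 := by
    intro S hS
    split_ifs with hSj
    swap
    · simp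
    set S' := natural S (cut p.val J) (cut p.val N) with hS'
    have hsub : P \ S ⊆ S' := by
      intro m hm
      simp only [hP, Finset.mem_sdiff, mem_cut, Finset.mem_union] at hm
      simp only [hS', mem_natural, mem_cut]
      tauto
    rw [smul_mul_assoc, mul_assoc, h.word_mul_hop hq (hlt S), mul_add, smul_add, ← mul_assoc]
    congr 1
    -- An index already in `S` cannot hop, since x_S x_m = 0; only `m` outside `S` contribute.
    rw [Finset.mul_sum, Finset.smul_sum, ← Finset.sum_subset hsub]
    · refine Finset.sum_congr rfl fun m hm => ?_
      rw [mul_smul_comm, smul_smul, ← mul_assoc (word x S), ← mul_assoc (word x S),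
        h.left.word_mul, if_neg (Finset.mem_sdiff.1 hm).2, smul_mul_assoc, smul_mul_assoc,
        smul_smul]
      congr 1
      ring
    · intro m hm hm'
      have hmS : m ∈ S := by
        by_contra hmS
        refine hm' (Finset.mem_sdiff.2 ⟨?_, hmS⟩)
        simp only [hS', mem_natural, mem_cut] at hm
        simp only [hP, mem_cut, Finset.mem_union]
        tauto
      rw [mul_smul_comm, ← mul_assoc, ← mul_assoc, h.left.word_mul, if_pos hmS]
      simp
  rw [Finset.sum_mul, Finset.sum_congr rfl step, Finset.sum_add_distrib, sum_powerset_sdiff]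
  congr 1
  refine Finset.sum_congr rfl fun T hT => ?_
  rw [Finset.mem_powerset] at hT
  have hTc : cut p.val T = T := cut_of_subset hT
  have hcard : ∀ m ∈ T, ((T.erase m).card = j ↔ T.card = j + 1) := by
    intro m hm
    have := Finset.card_pos.2 ⟨m, hm⟩
    rw [Finset.card_erase_of_mem hm]
    omega
  split_ifs with hTj
  swap
  · refine Finset.sum_eq_zero fun m hm => ?_
    rw [if_neg fun h' => hTj ((hcard m hm).1 h')]
  have hTJN : T ⊆ J ∪ N := hT.trans (Finset.filter_subset _ _)
  have hsc := sum_weight_erase hq hTJN p.2.le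
  have hh : height p.val J T = 1 := by
    rw [height, hTc, hTj, hj]; push_cast; ring
  rw [hh, hTc, sub_self, zpow_zero, Int.toNat_one, negQInt_one, one_mul, one_mul] at hsc
  rw [← hsc, Finset.sum_smul]
  refine Finset.sum_congr rfl fun m hm => ?_
  rw [if_pos ((hcard m hm).2 hTj), Finset.insert_erase hm]
  have hmp : m < p := (mem_cut.1 (hT hm)).2
  -- For `m` in both `J` and `N`, erasing it from `T` does not remove it from the complementary
  -- y-word, so `e1` below would fail; but then the weight is 0.
  by_cases hmJN : m ∈ J ∧ m ∈ N
  · rw [weight_eq_zero_of_mem q hmp hmJN.1 hmJN.2 (Finset.notMem_erase m T)]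
    simp
  · have hmJN' : m ∈ J ∨ m ∈ N := by simpa using hTJN hm
    have e1 : (natural (T.erase m) (cut p.val J) (cut p.val N)).erase m =
        natural T (cut p.val J) (cut p.val N) := by
      ext i
      simp only [Finset.mem_erase, mem_natural, mem_cut]
      by_cases him : i = m
      · subst him
        simp only [hm]
        tauto
      · tauto
    have e2 : (natural (T.erase m) (cut p.val J) (cut p.val N)).filter (m < ·) =
        (natural T (cut p.val J) (cut p.val N)).filter (m < ·) := by
      ext i
      simp only [Finset.mem_filter, mem_natural, mem_cut, Finset.mem_erase]
      by_cases him : i = m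
      · subst him; simp
      · tauto
    have e3 : (T.erase m).filter (m < ·) = T.filter (m < ·) := by
      ext i
      simp only [Finset.mem_filter, Finset.mem_erase]
      by_cases him : i = m
      · subst him; simp
      · tauto
    rw [e1, e2, e3, hopExp, hTc, cut_natural, zpow_sub₀ hq', zpow_natCast, zpow_natCast, inv_pow]
    congr 1
    ring

theorem QGrass.word_mul_word_cut (hq : q ≠ 0) (h : QGrass q x y) (J N : Finset (Fin n)) {c : ℕ}
    (hc : c ≤ n) :
    word y (cut c N) * word x (cut c J) =
      ∑ S ∈ (cut c (J ∪ N)).powerset, if S.card = (cut c J).card then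
        weight q c J N S • (word x S * word y (natural S (cut c J) (cut c N))) else 0 := by
  induction c with
  | zero => simp [weight_zero, natural]
  | succ c ih =>
    obtain ⟨p, rfl⟩ : ∃ p : Fin n, p.val = c := ⟨⟨c, hc⟩, rfl⟩
    specialize ih p.2.le
    have hlt : ∀ U : Finset (Fin n), ∀ m ∈ cut p.val U, m < p := fun U m hm => (mem_cut.1 hm).2
    have hlt' : ∀ S, ∀ m ∈ natural S (cut p.val J) (cut p.val N), m < p := by
      intro S m hm
      rw [← cut_natural, mem_cut] at hm
      exact hm.2
    have hpS : ∀ S ∈ (cut p.val (J ∪ N)).powerset, p ∉ S := fun S hS hp =>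
      lt_irrefl _ (hlt _ p (Finset.mem_powerset.1 hS hp))
    have hltS : ∀ S ∈ (cut p.val (J ∪ N)).powerset, ∀ m ∈ S, m < p := fun S hS m hm =>
      hlt _ m (Finset.mem_powerset.1 hS hm)
    have hcutS : ∀ S ∈ (cut p.val (J ∪ N)).powerset, cut p.val S = S := fun S hS =>
      cut_of_subset (Finset.mem_powerset.1 hS)
    have hcutS' : ∀ S ∈ (cut p.val (J ∪ N)).powerset, cut p.val (insert p S) = S := by
      intro S hS
      rw [← hcutS S hS]
      ext i
      simp only [mem_cut, Finset.mem_insert]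
      grind
    have hwS : ∀ S ∈ (cut p.val (J ∪ N)).powerset,
        weight q p.val J N (insert p S) = weight q p.val J N S := fun S hS =>
      weight_congr q J N (by rw [hcutS S hS, hcutS' S hS])
    have hhS : ∀ S ∈ (cut p.val (J ∪ N)).powerset,
        height p.val J S = (S.card : ℤ) - (cut p.val J).card := fun S hS => by
      rw [height, hcutS S hS]
    have hhS' : ∀ S ∈ (cut p.val (J ∪ N)).powerset,
        height p.val J (insert p S) = (S.card : ℤ) - (cut p.val J).card := fun S hS => by
      rw [height, hcutS' S hS]
    by_cases hpJ : p ∈ J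
    · rw [cut_succ_of_mem hpJ, cut_succ_of_mem (Finset.mem_union_left N hpJ),
        Finset.sum_powerset_insert (notMem_cut p _), Finset.card_insert_of_notMem (notMem_cut p J)]
      by_cases hpN : p ∈ N
      · rw [cut_succ_of_mem hpN, word_insert_max x (hlt J), word_insert_max y (hlt N), mul_assoc,
          ← mul_assoc (y p), h.mul_word_comm (hlt J), mul_assoc, ← mul_assoc, ih, h.diag,
          mul_smul_comm, ← mul_assoc, h.word_mul_mul hq J N p _ rfl, add_mul]
        -- When `p` lies in both sets, every hopped term ends in y_p and is followed by another y_p,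
        -- so it vanishes.
        have z1 : (∑ S ∈ (cut p.val (J ∪ N)).powerset, if S.card = (cut p.val J).card + 1 then
            weight q p.val J N S • (word x S * word y (natural S (cut p.val J) (cut p.val N)) * y p)
            else 0) * y p = 0 := by
          rw [Finset.sum_mul]
          refine Finset.sum_eq_zero fun S _ => ?_
          split_ifs
          · rw [smul_mul_assoc, mul_assoc, h.right.sq, mul_zero, smul_zero]
          · exact zero_mul _
        rw [z1, add_zero, Finset.sum_eq_zero (s := (cut p.val (J ∪ N)).powerset)
          (f := fun S => if S.card = _ + 1 then _ • (word x S * _) else 0), zero_add, Finset.sum_mul, Finset.smul_sum]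
        · refine Finset.sum_congr rfl fun S hS => ?_
          rw [Finset.card_insert_of_notMem (hpS S hS)]
          simp only [add_left_inj]
          split_ifs with hSj
          swap
          · simp
          have e : natural (insert p S) (insert p (cut p.val J)) (insert p (cut p.val N)) =
              insert p (natural S (cut p.val J) (cut p.val N)) := by
            ext i
            simp only [mem_natural, Finset.mem_insert, mem_cut]
            by_cases hi : i = p
            · simp [hi]
            · simp [hi]
          rw [e, weight_succ, hwS S hS, word_insert_max x (hltS S hS), word_insert_max y (hlt' S),
            smul_mul_assoc, smul_smul]
          simp [localWeight, hpJ, hpN, mul_comm, mul_assoc]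
        · intro S hS
          split_ifs
          · rw [weight_succ]
            simp [localWeight, hpJ, hpN, hpS S hS]
          · rfl
      · rw [cut_succ_of_notMem hpN, word_insert_max x (hlt J), ← mul_assoc, ih,
          h.word_mul_mul hq J N p _ rfl, add_comm]
        congr 1
        -- These are the hopped terms: `S` has height 1 at `p`, and the local factor is `negQInt q
        -- 1`, which is 1.
        · refine Finset.sum_congr rfl fun S hS => ?_
          split_ifs with hSj
          swap
          · rfl
          have e : natural S (insert p (cut p.val J)) (cut p.val N) =
              insert p (natural S (cut p.val J) (cut p.val N)) := by
            ext i
            simp only [mem_natural, Finset.mem_insert, mem_cut]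
            by_cases hi : i = p
            · simp [hi, hpS S hS]
            · simp [hi]
          rw [e, weight_succ, word_insert_max y (hlt' S), hhS S hS, hSj, mul_assoc]
          simp [localWeight, hpJ, hpN, hpS S hS]
        · refine Finset.sum_congr rfl fun S hS => ?_
          rw [Finset.card_insert_of_notMem (hpS S hS)]
          simp only [add_left_inj]
          split_ifs with hSj
          swap
          · rfl
          have e : natural (insert p S) (insert p (cut p.val J)) (cut p.val N) =
              natural S (cut p.val J) (cut p.val N) := by
            ext i
            simp only [mem_natural, Finset.mem_insert, mem_cut]
            by_cases hi : i = p
            · simp [hi]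
            · simp [hi]
          rw [e, weight_succ, hwS S hS, word_insert_max x (hltS S hS), hhS' S hS, hSj]
          simp [localWeight, hpJ, hpN]
    · rw [cut_succ_of_notMem hpJ]
      by_cases hpN : p ∈ N
      · rw [cut_succ_of_mem hpN, cut_succ_of_mem (Finset.mem_union_right J hpN),
          Finset.sum_powerset_insert (notMem_cut p _), word_insert_max y (hlt N), mul_assoc,
          h.mul_word_comm (hlt J), ← mul_assoc, ih]
        rw [Finset.sum_eq_zero (s := (cut p.val (J ∪ N)).powerset) (f := fun S =>
          if (insert p S).card = _ then _ else _), add_zero, Finset.sum_mul]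
        · refine Finset.sum_congr rfl fun S hS => ?_
          split_ifs with hSj
          swap
          · simp
          have e : natural S (cut p.val J) (insert p (cut p.val N)) =
              insert p (natural S (cut p.val J) (cut p.val N)) := by
            ext i
            simp only [mem_natural, Finset.mem_insert, mem_cut]
            by_cases hi : i = p
            · simp [hi, hpS S hS]
            · simp [hi]
          rw [e, weight_succ, word_insert_max y (hlt' S), hhS S hS, hSj, smul_mul_assoc, mul_assoc]
          simp [localWeight, hpJ, hpN, hpS S hS]
        -- With `p` in `N` but not in `J`, a set containing `p` has the right cardinality only if
        -- its part below `p` has height -1, so its weight is 0.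
        · intro S hS
          split_ifs with hSj
          · rw [Finset.card_insert_of_notMem (hpS S hS)] at hSj
            rw [weight_succ, hwS S hS,
              weight_eq_zero_of_height_neg q le_rfl p.2.le (by rw [hhS S hS]; omega)]
            simp
          · rfl
      · rw [cut_succ_of_notMem hpN, cut_succ_of_notMem (by simp [hpJ, hpN] : p ∉ J ∪ N), ih]
        refine Finset.sum_congr rfl fun S hS => ?_
        rw [weight_succ]
        simp [localWeight, hpJ, hpN, hpS S hS]

theorem QGrass.word_mul_word (hq : q ≠ 0) (h : QGrass q x y) (J N : Finset (Fin n)) :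
    word y N * word x J =
      ∑ S ∈ (J ∪ N).powerset, if S.card = J.card then
        weight q n J N S • (word x S * word y (natural S J N)) else 0 := by
  simpa only [cut_self] using h.word_mul_word_cut hq J N le_rfl

end Reorder

/-! ### A Fock-space model in which the monomials x_I y_M are independent. -/

section Fock

universe u

variable {k : Type*} [Field k] {W : Type*} [AddCommGroup W] [Module k W]

/-- The first creation operator at a new maximal site, with site basis `1, ξ, η, ξη`. -/
def createLeft (k W : Type*) [Field k] [AddCommGroup W] [Module k W] :
    Module.End k (W × W × W × W) where
  toFun f := (0, f.1, 0, f.2.2.1)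
  map_add' f g := by simp
  map_smul' c f := by simp

/-- The second creation operator at a new maximal site. -/
def createRight (q : k) (W : Type*) [AddCommGroup W] [Module k W] :
    Module.End k (W × W × W × W) where
  toFun f := (0, 0, f.1, q • f.2.1)
  map_add' f g := by simp
  map_smul' c f := by simp [smul_comm q c]

/-- The extension of an operator of the first family past a new maximal site. -/
def extendLeft (q : k) (x : Module.End k W) : Module.End k (W × W × W × W) where
  toFun f := (x f.1, (-q)⁻¹ • x f.2.1, x f.2.2.1, (-q)⁻¹ • x f.2.2.2)
  map_add' f g := by simp
  map_smul' c f := by simp [smul_comm _ c]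

/-- The extension of an operator of the second family past a new maximal site. -/
def extendRight (q : k) (x y : Module.End k W) : Module.End k (W × W × W × W) where
  toFun f := (y f.1, y f.2.1, (-q)⁻¹ • y f.2.2.1 + (q - q⁻¹) • x f.2.1, (-q)⁻¹ • y f.2.2.2)
  map_add' f g := by
    simp only [Prod.fst_add, Prod.snd_add, map_add, smul_add, Prod.mk_add_mk, Prod.mk.injEq,
      true_and, and_true]
    abel
  map_smul' c f := by simp [smul_comm _ c]

lemma createLeft_apply (f : W × W × W × W) :
    createLeft k W f = (0, f.1, 0, f.2.2.1) := rfl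

lemma createRight_apply (q : k) (f : W × W × W × W) :
    createRight q W f = (0, 0, f.1, q • f.2.1) := rfl

lemma extendLeft_apply (q : k) (x : Module.End k W) (f : W × W × W × W) :
    extendLeft q x f = (x f.1, (-q)⁻¹ • x f.2.1, x f.2.2.1, (-q)⁻¹ • x f.2.2.2) := rfl

lemma extendRight_apply (q : k) (x y : Module.End k W) (f : W × W × W × W) :
    extendRight q x y f =
      (y f.1, y f.2.1, (-q)⁻¹ • y f.2.2.1 + (q - q⁻¹) • x f.2.1, (-q)⁻¹ • y f.2.2.2) := rfl

variable {ι : Type*} [LinearOrder ι]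

/-- The mixing term of `extendRight` sends ξ to η through `x i`, which is what produces the
correction (q - q⁻¹) x_i y_a in the `cross` relation with the new site `a`. Vanishing off `s` makes
the relations with indices beyond `a` trivial. -/
lemma QGrass.extend {q : k} (hq : q ≠ 0) {x y : ι → Module.End k W} (h : QGrass q x y) {s : Finset ι}
    {a : ι} (ha : ∀ b ∈ s, b < a) (hx : ∀ i ∉ s, x i = 0) (hy : ∀ i ∉ s, y i = 0) :
    QGrass q (Function.update (fun i => extendLeft q (x i)) a (createLeft k W))
      (Function.update (fun i => extendRight q (x i) (y i)) a (createRight q W)) := by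
  have has : a ∉ s := fun h' => lt_irrefl _ (ha a h')
  have hgt : ∀ j, a < j → j ∉ s := fun j hj hjs => lt_asymm hj (ha j hjs)
  have sqx : ∀ i w, x i (x i w) = 0 := fun i w => LinearMap.congr_fun (h.left.sq i) w
  have sqy : ∀ i w, y i (y i w) = 0 := fun i w => LinearMap.congr_fun (h.right.sq i) w
  have dg : ∀ i w, y i (x i w) = q • x i (y i w) := fun i w => LinearMap.congr_fun (h.diag i) w
  have swx : ∀ {i j}, i < j → ∀ w, x j (x i w) = (-q) • x i (x j w) :=
    fun hij w => LinearMap.congr_fun (h.left.swap hij) w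
  have swy : ∀ {i j}, i < j → ∀ w, y j (y i w) = (-q) • y i (y j w) :=
    fun hij w => LinearMap.congr_fun (h.right.swap hij) w
  have cm : ∀ {i j}, i < j → ∀ w, y j (x i w) = x i (y j w) :=
    fun hij w => LinearMap.congr_fun (h.comm hij) w
  have cr : ∀ {i j}, i < j → ∀ w, y i (x j w) = x j (y i w) + (q - q⁻¹) • x i (y j w) :=
    fun hij w => LinearMap.congr_fun (h.cross hij) w
  have split : ∀ {i j}, i < j → (j = a ∧ i ≠ a) ∨ (i = a ∧ j ≠ a ∧ j ∉ s) ∨ (i ≠ a ∧ j ≠ a) := by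
    intro i j hij
    rcases eq_or_ne j a with rfl | hj
    · exact .inl ⟨rfl, hij.ne⟩
    · rcases eq_or_ne i a with rfl | hi
      · exact .inr (.inl ⟨rfl, hj, hgt j hij⟩)
      · exact .inr (.inr ⟨hi, hj⟩)
  refine ⟨⟨fun i => ?_, fun {i j} hij => ?_⟩, ⟨fun i => ?_, fun {i j} hij => ?_⟩, fun i => ?_,
    fun {i j} hij => ?_, fun {i j} hij => ?_⟩ <;>
  refine LinearMap.ext fun f => ?_
  · rcases eq_or_ne i a with rfl | hi
    · simp [createLeft_apply]
    · simp [hi, extendLeft_apply, sqx]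
  · rcases split hij with ⟨rfl, hi⟩ | ⟨rfl, hj, hjs⟩ | ⟨hi, hj⟩
    · simp [hi, extendLeft_apply, createLeft_apply, hq]
    · simp [hj, hx j hjs, extendLeft_apply, createLeft_apply]
    · simp [hi, hj, extendLeft_apply, swx hij, smul_comm q]
  · rcases eq_or_ne i a with rfl | hi
    · simp [createRight_apply]
    · simp [hi, extendRight_apply, sqy, dg]
      match_scalars
      field_simp
      ring
  · rcases split hij with ⟨rfl, hi⟩ | ⟨rfl, hj, hjs⟩ | ⟨hi, hj⟩
    · simp [hi, extendRight_apply, createRight_apply, hq, smul_smul]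
    · simp [hj, hx j hjs, hy j hjs, extendRight_apply, createRight_apply]
    · simp [hi, hj, extendRight_apply, swy hij, cr hij, cm hij]
      refine ⟨?_, ?_⟩ <;> match_scalars <;> field_simp <;> ring
  · rcases eq_or_ne i a with rfl | hi
    · simp [createRight_apply, createLeft_apply]
    · simp [hi, extendRight_apply, extendLeft_apply, sqx, dg]
      refine ⟨?_, ?_, ?_⟩ <;> match_scalars <;> field_simp
  · rcases split hij with ⟨rfl, hi⟩ | ⟨rfl, hj, hjs⟩ | ⟨hi, hj⟩
    · simp [hi, extendLeft_apply, createRight_apply, hq, smul_smul]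
    · simp [hj, hy j hjs, hx j hjs, extendRight_apply, createLeft_apply]
    · simp [hi, hj, extendRight_apply, extendLeft_apply, swx hij, cm hij]
      match_scalars
      field_simp
  · rcases split hij with ⟨rfl, hi⟩ | ⟨rfl, hj, hjs⟩ | ⟨hi, hj⟩
    · simp [hi, extendLeft_apply, extendRight_apply, createLeft_apply, createRight_apply, hq,
        smul_smul]
    · simp [hj, hx j hjs, hy j hjs, extendLeft_apply, extendRight_apply, createLeft_apply,
        createRight_apply]
    · simp [hi, hj, extendRight_apply, extendLeft_apply, cr hij, swx hij]
      refine ⟨?_, ?_, ?_⟩ <;> match_scalars <;> field_simp <;> ring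

/-- Sites are added in increasing order, each multiplying the space by a four-dimensional factor.
The functionals φ are dual to the vectors x_I y_M v, which gives independence without having to
exhibit a basis. Vanishing off `s` is carried along because `QGrass.extend` needs it. -/
theorem exists_fock {k : Type u} [Field k] {q : k} (hq : q ≠ 0) (s : Finset ι) :
    ∃ (W : Type u) (_ : AddCommGroup W) (_ : Module k W) (x y : ι → Module.End k W) (v : W)
      (φ : Finset ι → Finset ι → W →ₗ[k] k), QGrass q x y ∧ (∀ i ∉ s, x i = 0) ∧
      (∀ i ∉ s, y i = 0) ∧ ∀ I ⊆ s, ∀ M ⊆ s, ∀ I' ⊆ s, ∀ M' ⊆ s,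
        φ I M (word x I' (word y M' v)) = if I = I' ∧ M = M' then 1 else 0 := by
  have hq' : -q ≠ 0 := neg_ne_zero.2 hq
  induction s using Finset.induction_on_max with
  | empty =>
    refine ⟨k, inferInstance, inferInstance, 0, 0, 1, fun _ _ => LinearMap.id, ?_, by simp, by simp,
      ?_⟩
    · constructor <;> first | constructor <;> simp | simp
    · intro I hI M hM I' hI' M' hM'
      simp only [Finset.subset_empty] at hI hM hI' hM'
      simp [hI, hM, hI', hM']
  | insert a s ha ih =>
    obtain ⟨W, _, _, x, y, v, φ, h, hx, hy, hφ⟩ := ih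
    have has : a ∉ s := fun h' => lt_irrefl _ (ha a h')
    set X := Function.update (fun i => extendLeft q (x i)) a (createLeft k W) with hX
    set Y := Function.update (fun i => extendRight q (x i) (y i)) a (createRight q W) with hY
    have hXw : ∀ I ⊆ s, ∀ f : W × W × W × W, word X I f =
        (word x I f.1, (-q)⁻¹ ^ I.card • word x I f.2.1, word x I f.2.2.1,
          (-q)⁻¹ ^ I.card • word x I f.2.2.2) := by
      intro I
      induction I using Finset.induction_on_max with
      | empty => simp
      | insert m T hm ih =>
        intro hI f
        have hma : m ≠ a := fun h' => has (h' ▸ hI (Finset.mem_insert_self _ _))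
        rw [word_insert_max X hm, word_insert_max x hm, Module.End.mul_apply,
          ih fun i hi => hI (Finset.mem_insert_of_mem hi),
          Finset.card_insert_of_notMem fun h' => lt_irrefl _ (hm m h')]
        simp [hX, hma, extendLeft_apply, pow_succ, smul_smul]
    -- Words in `Y` act before any `X a`, so only vectors without ξ and ξη components occur, and the
    -- mixing term of `extendRight` never enters.
    have hYw : ∀ M ⊆ s, ∀ w₀ w₂ : W, word Y M (w₀, 0, w₂, 0) =
        (word y M w₀, 0, (-q)⁻¹ ^ M.card • word y M w₂, 0) := by
      intro I
      induction I using Finset.induction_on_max with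
      | empty => simp
      | insert m T hm ih =>
        intro hI w₀ w₂
        have hma : m ≠ a := fun h' => has (h' ▸ hI (Finset.mem_insert_self _ _))
        have : Y m (w₀, 0, w₂, 0) = (y m w₀, 0, (-q)⁻¹ • y m w₂, 0) := by
          simp [hY, hma, extendRight_apply]
        rw [word_insert_max Y hm, word_insert_max y hm, Module.End.mul_apply, this,
          ih fun i hi => hI (Finset.mem_insert_of_mem hi),
          Finset.card_insert_of_notMem fun h' => lt_irrefl _ (hm m h')]
        simp [pow_succ, smul_smul]
    -- Being maximal, `a` acts first in each word, and every later operator of the same family then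
    -- contributes a factor (-q)⁻¹. `e` counts these factors, and the new functionals are rescaled
    -- by (-q)^e to cancel them.
    set e : Finset ι → Finset ι → ℕ := fun I M =>
      (if a ∈ I then (I.erase a).card else 0) + if a ∈ M then (M.erase a).card else 0 with he
    have hXa : ∀ I ⊆ s, ∀ f : W × W × W × W, word X (insert a I) f =
        (0, (-q)⁻¹ ^ I.card • word x I f.1, 0, (-q)⁻¹ ^ I.card • word x I f.2.2.1) := by
      intro I hI f
      rw [word_insert_max X fun i hi => ha i (hI hi), Module.End.mul_apply, hXw I hI]
      simp [hX, createLeft_apply]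
    have hYa : ∀ M ⊆ s, word Y (insert a M) (v, 0, 0, 0) =
        (0, 0, (-q)⁻¹ ^ M.card • word y M v, 0) := by
      intro M hM
      have : Y a (v, 0, 0, 0) = (0, 0, v, 0) := by simp [hY, createRight_apply]
      rw [word_insert_max Y fun i hi => ha i (hM hi), Module.End.mul_apply, this, hYw M hM]
      simp
    have hY0 : ∀ M ⊆ s, word Y M (v, 0, 0, 0) = (word y M v, 0, 0, 0) := by
      intro M hM
      rw [hYw M hM]
      simp
    set pr : Finset ι → Finset ι → (W × W × W × W) →ₗ[k] W := fun I M =>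
      if a ∈ I then
        if a ∈ M then LinearMap.snd k W W ∘ₗ LinearMap.snd k W _ ∘ₗ LinearMap.snd k W _
        else LinearMap.fst k W _ ∘ₗ LinearMap.snd k W _
      else
        if a ∈ M then LinearMap.fst k W W ∘ₗ LinearMap.snd k W _ ∘ₗ LinearMap.snd k W _
        else LinearMap.fst k W _ with hpr
    have hsub : ∀ I ⊆ insert a s, I.erase a ⊆ s := fun I hI => by
      rwa [← Finset.subset_insert_iff]
    have hpw : ∀ I M, ∀ I' ⊆ insert a s, ∀ M' ⊆ insert a s,
        pr I M (word X I' (word Y M' (v, 0, 0, 0))) =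
          if (a ∈ I ↔ a ∈ I') ∧ (a ∈ M ↔ a ∈ M') then
            (-q)⁻¹ ^ e I' M' • word x (I'.erase a) (word y (M'.erase a) v) else 0 := by
      intro I M I' hI' M' hM'
      have hI'' := hsub I' hI'
      have hM'' := hsub M' hM'
      by_cases h1 : a ∈ I' <;> by_cases h2 : a ∈ M'
      · rw [← Finset.insert_erase h1, ← Finset.insert_erase h2, hYa _ hM'', hXa _ hI'']
        by_cases h3 : a ∈ I <;> by_cases h4 : a ∈ M <;>
          simp [hpr, h3, h4, he, smul_smul, pow_add]
      · rw [← Finset.insert_erase h1, ← Finset.erase_eq_of_notMem h2, hY0 _ hM'', hXa _ hI'']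
        by_cases h3 : a ∈ I <;> by_cases h4 : a ∈ M <;>
          simp [hpr, h3, h4, he]
      · rw [← Finset.erase_eq_of_notMem h1, ← Finset.insert_erase h2, hYa _ hM'', hXw _ hI'']
        by_cases h3 : a ∈ I <;> by_cases h4 : a ∈ M <;>
          simp [hpr, h3, h4, he]
      · rw [← Finset.erase_eq_of_notMem h1, ← Finset.erase_eq_of_notMem h2, hY0 _ hM'',
          hXw _ hI'']
        by_cases h3 : a ∈ I <;> by_cases h4 : a ∈ M <;>
          simp [hpr, h3, h4, he]
    have herase : ∀ I I' : Finset ι, (a ∈ I ↔ a ∈ I') → (I.erase a = I'.erase a ↔ I = I') := by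
      intro I I' h
      refine ⟨fun h' => ?_, fun h' => h' ▸ rfl⟩
      ext i
      by_cases hi : i = a
      · rw [hi, h]
      · have := Finset.ext_iff.1 h' i
        simpa [hi] using this
    refine ⟨W × W × W × W, inferInstance, inferInstance, X, Y, (v, 0, 0, 0), fun I M =>
      (-q) ^ e I M • (φ (I.erase a) (M.erase a) ∘ₗ pr I M), h.extend hq ha hx hy, ?_, ?_, ?_⟩
    · intro i hi
      rw [Finset.mem_insert, not_or] at hi
      refine LinearMap.ext fun f => ?_
      simp [hX, hi.1, extendLeft_apply, hx i hi.2]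
    · intro i hi
      rw [Finset.mem_insert, not_or] at hi
      refine LinearMap.ext fun f => ?_
      simp [hY, hi.1, extendRight_apply, hx i hi.2, hy i hi.2]
    · intro I hI M hM I' hI' M' hM'
      rw [LinearMap.smul_apply, LinearMap.comp_apply, hpw I M I' hI' M' hM']
      split_ifs with h1 h2 h2
      · rw [map_smul, hφ _ (hsub I hI) _ (hsub M hM) _ (hsub I' hI') _ (hsub M' hM'),
          if_pos ⟨(herase _ _ h1.1).2 h2.1, (herase _ _ h1.2).2 h2.2⟩, h2.1, h2.2, smul_smul,
          inv_pow, mul_inv_cancel₀ (pow_ne_zero _ hq')]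
        simp
      · rw [map_smul, hφ _ (hsub I hI) _ (hsub M hM) _ (hsub I' hI') _ (hsub M' hM'),
          if_neg fun h' => h2 ⟨(herase _ _ h1.1).1 h'.1, (herase _ _ h1.2).1 h'.2⟩]
        simp
      · exact absurd ⟨by rw [h2.1], by rw [h2.2]⟩ h1
      · simp

end Fock

/-! ### The coaction of the quantum matrix algebra, and minors as its coefficients. -/

section Coaction

variable {k : Type*} [Field k] {n : ℕ} {q : k}

lemma X_col {i l : Fin n} (j : Fin n) (h : i < l) : X q i j * X q l j = q • (X q l j * X q i j) := by
  simpa only [map_mul, map_smul, X] using RingQuot.mkAlgHom_rel k (Rel.col (q := q) i l j h)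

lemma X_row (i : Fin n) {j m : Fin n} (h : j < m) : X q i j * X q i m = q • (X q i m * X q i j) := by
  simpa only [map_mul, map_smul, X] using RingQuot.mkAlgHom_rel k (Rel.row (q := q) i j m h)

lemma X_comm {i l j m : Fin n} (hil : i < l) (hjm : j < m) :
    X q l j * X q i m = X q i m * X q l j := by
  simpa only [map_mul, X] using (RingQuot.mkAlgHom_rel k (Rel.comm (q := q) i l m j hil hjm)).symm

lemma X_cross {i l j m : Fin n} (hil : i < l) (hjm : j < m) :
    X q i j * X q l m = X q l m * X q i j + (q - q⁻¹) • (X q i m * X q l j) := by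
  have := RingQuot.mkAlgHom_rel k (Rel.cross (q := q) i l j m hil hjm)
  simp only [map_mul, map_smul, map_sub] at this
  exact sub_eq_iff_eq_add'.1 this

/-- The relations for coacted generators do not hold term by term, only after the terms at (a, b)
and (b, a) are added. -/
lemma sum_sum_congr_of_symm {ι M : Type*} [Fintype ι] [LinearOrder ι] [AddCommMonoid M]
    {F G : ι → ι → M} (hd : ∀ a, F a a = G a a)
    (ho : ∀ a b, a < b → F a b + F b a = G a b + G b a) :
    ∑ a, ∑ b, F a b = ∑ a, ∑ b, G a b := by
  have key : ∀ F : ι → ι → M, ∑ a, ∑ b, F a b =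
      ∑ a, ∑ b, ((if a = b then F a b else 0) + if a < b then F a b + F b a else 0) := by
    intro F
    have h1 : ∀ a b, F a b = ((if a = b then F a b else 0) + if a < b then F a b else 0) +
        if b < a then F a b else 0 := by
      intro a b
      rcases lt_trichotomy a b with h | h | h
      · simp [h, h.ne, h.le.not_gt]
      · simp [h]
      · simp [h, h.ne', h.le.not_gt]
    have h2 : ∀ a b, ((if a = b then F a b else 0) + if a < b then F a b + F b a else 0) =
        ((if a = b then F a b else 0) + if a < b then F a b else 0) +
          if a < b then F b a else 0 := by
      intro a b
      split_ifs <;> simp [add_assoc]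
    rw [Finset.sum_congr rfl fun a _ => Finset.sum_congr rfl fun b _ => h1 a b,
      Finset.sum_congr rfl fun a _ => Finset.sum_congr rfl fun b _ => h2 a b]
    simp only [Finset.sum_add_distrib]
    congr 1
    rw [Finset.sum_comm]
  rw [key F, key G]
  refine Finset.sum_congr rfl fun a _ => Finset.sum_congr rfl fun b _ => ?_
  split_ifs with h1 h2 h2
  · exact absurd h2 (h1 ▸ lt_irrefl _)
  · rw [h1, hd]
  · rw [ho a b h2]
  · rfl

variable {E : Type*} [Ring E] [Algebra k E]

/-- The coaction `x_j ↦ ∑ i, X_{ij} ⊗ x_i`. -/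
noncomputable def coact (q : k) (x : Fin n → E) (j : Fin n) : Oq k n q ⊗[k] E :=
  ∑ i, X q i j ⊗ₜ[k] x i

lemma coact_mul_coact (x y : Fin n → E) (i j : Fin n) :
    coact q x i * coact q y j = ∑ a, ∑ b, (X q a i * X q b j) ⊗ₜ[k] (x a * y b) := by
  simp [coact, Finset.sum_mul_sum]

lemma QExt.coact (hq : q ≠ 0) {x : Fin n → E} (h : QExt q x) : QExt q (coact q x) where
  sq i := by
    rw [coact_mul_coact, ← Finset.sum_const_zero (s := Finset.univ (α := Fin n)),
      ← Finset.sum_congr rfl fun _ _ => Finset.sum_const_zero (s := Finset.univ (α := Fin n))]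
    refine sum_sum_congr_of_symm (fun a => by simp [h.sq]) fun a b hab => ?_
    rw [h.swap hab, X_col i hab]
    simp only [TensorProduct.tmul_smul, ← TensorProduct.smul_tmul']
    match_scalars
    ring
  swap {i j} hij := by
    simp only [coact_mul_coact, Finset.smul_sum]
    refine sum_sum_congr_of_symm (fun a => by simp [h.sq]) fun a b hab => ?_
    rw [h.swap hab, X_comm hab hij, X_cross hab hij]
    simp only [TensorProduct.tmul_smul, ← TensorProduct.smul_tmul', TensorProduct.add_tmul]
    match_scalars <;> field_simp
    ring

/-- For each pair of rows a < b, the relations of `x`, `y` and those of the X_{ij} bring both sides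
to the same ordered monomials; what is left is an identity of scalars in q. -/
theorem QGrass.coact (hq : q ≠ 0) {x y : Fin n → E} (h : QGrass q x y) :
    QGrass q (coact q x) (coact q y) where
  left := h.left.coact hq
  right := h.right.coact hq
  diag i := by
    simp only [coact_mul_coact, Finset.smul_sum]
    refine sum_sum_congr_of_symm (fun a => by simp [h.diag]) fun a b hab => ?_
    rw [h.cross hab, h.comm hab, X_col i hab]
    simp only [TensorProduct.tmul_smul, ← TensorProduct.smul_tmul', TensorProduct.tmul_add]
    match_scalars <;> field_simp
    ring
  comm {i j} hij := by
    simp only [coact_mul_coact]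
    refine sum_sum_congr_of_symm (fun a => ?_) fun a b hab => ?_
    · rw [h.diag, X_row a hij, TensorProduct.smul_tmul]
    rw [h.cross hab, h.comm hab, X_comm hab hij, X_cross hab hij]
    simp only [TensorProduct.tmul_smul, ← TensorProduct.smul_tmul', TensorProduct.tmul_add,
      TensorProduct.add_tmul]
    match_scalars <;> field_simp
  cross {i j} hij := by
    simp only [coact_mul_coact, Finset.smul_sum, ← Finset.sum_add_distrib]
    refine sum_sum_congr_of_symm (fun a => ?_) fun a b hab => ?_
    · rw [h.diag, X_row a hij]
      simp only [TensorProduct.tmul_smul, ← TensorProduct.smul_tmul']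
      match_scalars
      field_simp
      ring
    rw [h.cross hab, h.comm hab, X_comm hab hij, X_cross hab hij]
    simp only [TensorProduct.tmul_smul, ← TensorProduct.smul_tmul', TensorProduct.tmul_add,
      TensorProduct.add_tmul]
    match_scalars <;> field_simp <;> ring

lemma prod_ofFn_coact (x : Fin n → E) {t : ℕ} (c : Fin t → Fin n) :
    (List.ofFn fun l => coact q x (c l)).prod = ∑ f : Fin t → Fin n,
      (List.ofFn fun l => X q (f l) (c l)).prod ⊗ₜ[k] (List.ofFn fun l => x (f l)).prod := by
  induction t with
  | zero => simp [Algebra.TensorProduct.one_def]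
  | succ t ih =>
    rw [List.ofFn_succ, List.prod_cons, ih fun l => c l.succ, coact, Finset.sum_mul_sum,
      ← (Fin.consEquiv fun _ => Fin n).sum_comp, Fintype.sum_prod_type]
    refine Finset.sum_congr rfl fun a _ => Finset.sum_congr rfl fun f _ => ?_
    simp [Fin.consEquiv, List.ofFn_succ]

/-- The number of inversions of a function. -/
def inversions {t : ℕ} {ι : Type*} [LinearOrder ι] (f : Fin t → ι) : ℕ :=
  (Finset.univ.filter fun p : Fin t × Fin t => p.1 < p.2 ∧ f p.2 < f p.1).card

lemma inversions_succ {t : ℕ} {ι : Type*} [LinearOrder ι] (f : Fin (t + 1) → ι) :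
    inversions f = (Finset.univ.filter fun l : Fin t => f l.succ < f 0).card +
      inversions fun l : Fin t => f l.succ := by
  simp only [inversions, Finset.card_filter, Fintype.sum_prod_type, Fin.sum_univ_succ]
  simp only [lt_self_iff_false, false_and, if_false, Fin.succ_pos, true_and, Fin.not_lt_zero,
    Fin.succ_lt_succ_iff, zero_add]

lemma QExt.prod_ofFn {ι : Type*} [LinearOrder ι] {x : ι → E} (h : QExt q x) {t : ℕ}
    (f : Fin t → ι) [Decidable (Function.Injective f)] :
    (List.ofFn fun l => x (f l)).prod = if Function.Injective f then
      (-q) ^ inversions f • word x (Finset.univ.image f) else 0 := by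
  classical
  induction t with
  | zero => simp [Function.injective_of_subsingleton, inversions]
  | succ t ih =>
    have himg : Finset.univ.image f =
        insert (f 0) (Finset.univ.image fun l : Fin t => f l.succ) := by
      rw [Fin.univ_succ, Finset.cons_eq_insert, Finset.image_insert, Finset.map_eq_image,
        Finset.image_image]
      rfl
    have hinj : Function.Injective f ↔ f 0 ∉ Finset.univ.image (fun l : Fin t => f l.succ) ∧
        Function.Injective fun l : Fin t => f l.succ := by
      conv_lhs => rw [← Fin.cons_self_tail f, Fin.cons_injective_iff]
      simp [Fin.tail_def]
    rw [List.ofFn_succ, List.prod_cons, ih]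
    by_cases h1 : Function.Injective fun l : Fin t => f l.succ
    · rw [if_pos h1, mul_smul_comm, h.mul_word]
      by_cases h2 : f 0 ∈ Finset.univ.image (fun l : Fin t => f l.succ)
      · rw [if_pos h2, if_neg fun h' => (hinj.1 h').1 h2, smul_zero]
      · rw [if_neg h2, if_pos (hinj.2 ⟨h2, h1⟩), inversions_succ, himg, Finset.filter_image,
          Finset.card_image_of_injective _ h1, smul_smul, ← pow_add, add_comm]
    · rw [if_neg h1, if_neg fun h' => h1 (hinj.1 h').2, mul_zero]

lemma sum_injective_image_eq {ι M : Type*} [LinearOrder ι] [Fintype ι] [AddCommMonoid M] {t : ℕ}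
    {I : Finset ι} (hI : I.card = t) (F : (Fin t → ι) → M)
    [DecidablePred fun f : Fin t → ι => Finset.univ.image f = I ∧ Function.Injective f] :
    ∑ f ∈ Finset.univ.filter (fun f : Fin t → ι =>
        Finset.univ.image f = I ∧ Function.Injective f), F f =
      ∑ σ : Equiv.Perm (Fin t), F fun l => I.orderEmbOfFin hI (σ l) := by
  symm
  refine Finset.sum_bij (fun σ _ l => I.orderEmbOfFin hI (σ l)) ?_ ?_ ?_ ?_
  · intro σ _
    simp only [Finset.mem_filter, Finset.mem_univ, true_and]
    refine ⟨?_, (I.orderEmbOfFin hI).injective.comp σ.injective⟩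
    ext i
    have : i ∈ Set.range (I.orderEmbOfFin hI) ↔ i ∈ I := by
      rw [Finset.range_orderEmbOfFin]; rfl
    rw [← this]
    simp only [Finset.mem_image, Finset.mem_univ, true_and, Set.mem_range]
    exact ⟨fun ⟨l, hl⟩ => ⟨σ l, hl⟩, fun ⟨l, hl⟩ => ⟨σ.symm l, by simpa using hl⟩⟩
  · intro σ _ τ _ h
    ext l
    have := (I.orderEmbOfFin hI).injective (congrFun h l)
    rw [this]
  · intro f hf
    simp only [Finset.mem_filter, Finset.mem_univ, true_and] at hf
    have hmem : ∀ l, ∃ m, I.orderEmbOfFin hI m = f l := by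
      intro l
      have : f l ∈ Set.range (I.orderEmbOfFin hI) := by
        rw [Finset.range_orderEmbOfFin, ← hf.1]
        simp
      exact this
    choose g hg using hmem
    have hginj : Function.Injective g := fun a b hab => hf.2 (by rw [← hg, ← hg, hab])
    refine ⟨Equiv.ofBijective g (Finite.injective_iff_bijective.1 hginj), Finset.mem_univ _, ?_⟩
    funext l
    simp [hg]
  · intros
    rfl

lemma minor_eq {I J : Finset (Fin n)} {t : ℕ} (hI : I.card = t) (hJ : J.card = t) :
    minor q I J = ∑ σ : Equiv.Perm (Fin t), (-q) ^ permLength σ •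
      (List.ofFn fun l => X q (I.orderEmbOfFin hI (σ l)) (J.orderEmbOfFin hJ l)).prod := by
  subst hI
  rw [minor, dif_pos hJ]

lemma minor_eq_zero {I J : Finset (Fin n)} (h : J.card ≠ I.card) : minor q I J = 0 := by
  rw [minor, dif_neg h]

lemma sort_eq_ofFn {ι : Type*} [LinearOrder ι] (J : Finset ι) :
    J.sort (· ≤ ·) = List.ofFn (J.orderEmbOfFin rfl) := by
  refine List.ext_getElem (by simp) fun i h1 h2 => ?_
  simp [Finset.orderEmbOfFin_apply]

/-- Expanding the product gives a sum over functions `f` from positions to rows. Non-injective `f`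
die because x_i² = 0; those with image `I` are the permutations of `I`, and sorting the x-word
yields (-q)^{ℓ(σ)}, the coefficient in the quantum minor. -/
theorem QExt.word_coact {x : Fin n → E} (h : QExt q x) (J : Finset (Fin n)) :
    word (QMat.coact q x) J = ∑ I, minor q I J ⊗ₜ[k] word x I := by
  classical
  rw [word, sort_eq_ofFn, List.map_ofFn]
  change (List.ofFn fun l => QMat.coact q x (J.orderEmbOfFin rfl l)).prod = _
  rw [prod_ofFn_coact]
  simp only [h.prod_ofFn]
  rw [← Finset.sum_fiberwise Finset.univ (fun f : Fin J.card → Fin n => Finset.univ.image f)]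
  refine Finset.sum_congr rfl fun I _ => ?_
  rw [Finset.sum_congr rfl (g := fun f : Fin J.card → Fin n => if Function.Injective f then
    ((-q) ^ inversions f • (List.ofFn fun l => X q (f l) (J.orderEmbOfFin rfl l)).prod) ⊗ₜ[k]
      word x I else 0)]
  swap
  · intro f hf
    rw [(Finset.mem_filter.1 hf).2]
    split_ifs
    · rw [TensorProduct.smul_tmul]
    · rw [TensorProduct.tmul_zero]
  rw [← Finset.sum_filter, Finset.filter_filter]
  by_cases hI : I.card = J.card
  · rw [minor_eq hI rfl, TensorProduct.sum_tmul, sum_injective_image_eq hI]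
    refine Finset.sum_congr rfl fun σ _ => ?_
    have : inversions (fun l => I.orderEmbOfFin hI (σ l)) = permLength σ := by
      simp only [inversions, permLength, OrderEmbedding.lt_iff_lt]
    rw [this]
  · rw [minor_eq_zero (Ne.symm hI), TensorProduct.zero_tmul]
    refine Finset.sum_eq_zero fun f hf => absurd ?_ hI
    obtain ⟨hf2, hf1⟩ := (Finset.mem_filter.1 hf).2
    rw [← hf2, Finset.card_image_of_injective _ hf1, Finset.card_univ, Fintype.card_fin]

end Coaction

/-! ### Identification of the weights with λ and μ. -/

section Coefficients

variable {k : Type*} [Field k] {n : ℕ}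

lemma card_filter_lt_orderEmbOfFin {ι : Type*} [LinearOrder ι] (S : Finset ι) {t : ℕ}
    (h : S.card = t) (l : Fin t) : (S.filter (· < S.orderEmbOfFin h l)).card = l := by
  have hS := Finset.map_orderEmbOfFin_univ S h
  generalize S.orderEmbOfFin h = e at hS ⊢
  rw [← hS, Finset.filter_map, Finset.card_map]
  have : Finset.univ.filter ((· < e l) ∘ e.toEmbedding) = Finset.Iio l := by
    ext i; simp
  rw [this, Fin.card_Iio]

lemma xi_eq_prod (q : k) (I J : Finset (Fin n)) :
    xi q I J = ∏ r ∈ I, negQInt q ((J.filter (· ≤ r)).card - (I.filter (· < r)).card) := by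
  conv_rhs => rw [← Finset.map_orderEmbOfFin_univ I rfl]
  rw [Finset.prod_map, xi]
  refine Finset.prod_congr rfl fun l _ => ?_
  rw [Finset.map_orderEmbOfFin_univ]
  simp [card_filter_lt_orderEmbOfFin]

lemma ell_eq_sum (S T : Finset (Fin n)) : ell S T = ∑ s ∈ S, (T.filter (· < s)).card := by
  simp only [ell, Finset.card_filter, Finset.sum_product]

lemma height_eq (p : Fin n) (J S : Finset (Fin n)) :
    height p.val J S = (((S \ J).filter (· < p)).card : ℤ) - ((J \ S).filter (· < p)).card := by
  have key : ∀ A B : Finset (Fin n), (cut p.val A).card =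
      ((A \ B).filter (· < p)).card + ((A ∩ B).filter (· < p)).card := by
    intro A B
    rw [← Finset.card_union_of_disjoint, ← Finset.filter_union, Finset.sdiff_union_inter]
    · rfl
    · exact Finset.disjoint_filter_filter (Finset.disjoint_sdiff_inter A B)
  rw [height, key S J, key J S, Finset.inter_comm]
  push_cast
  ring

lemma prod_zpow_eq {ι : Type*} {a : k} (ha : a ≠ 0) (s : Finset ι) (f : ι → ℤ) :
    ∏ i ∈ s, a ^ f i = a ^ ∑ i ∈ s, f i := by
  classical
  induction s using Finset.induction_on with
  | empty => simp
  | insert i s hi ih => rw [Finset.prod_insert hi, Finset.sum_insert hi, zpow_add₀ ha, ih]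

/-- The local factors separate by type: q on J ∩ N, q - q⁻¹ on S \ J, a power of -q on `W`, and a
(-q)-integer on J \ S. Writing heights as differences of counts in S \ J and J \ S turns the last
two products into (-q)^𝓛 and ξ_q. -/
lemma weight_eq_lam {q : k} (hq : q ≠ 0) {J N S : Finset (Fin n)} (h1 : J ∩ N ⊆ S)
    (h2 : S ⊆ J ∪ N) (h3 : S.card = J.card) :
    weight q n J N S = q ^ (J ∩ N).card * lam q S J N := by
  have hq' : -q ≠ 0 := neg_ne_zero.2 hq
  set W := (S \ natural S J N) ∪ (N \ J) with hW
  have hloc : ∀ p, localWeight q (p ∈ J) (p ∈ N) (p ∈ S) (height p.val J S) =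
      (if p ∈ J ∩ N then q else 1) * (if p ∈ S \ J then q - q⁻¹ else 1) *
      (if p ∈ W then (-q) ^ (-height p.val J S) else 1) *
      (if p ∈ J \ S then negQInt q (height p.val J S).toNat else 1) := by
    intro p
    have e1 : p ∈ J → p ∈ N → p ∈ S := fun a b => h1 (Finset.mem_inter.2 ⟨a, b⟩)
    have e2 : p ∈ S → p ∈ J ∨ p ∈ N := fun a => Finset.mem_union.1 (h2 a)
    have e3 : p ∈ W ↔ (p ∈ S ∧ ¬ ((p ∈ J ∧ p ∈ N) ∨ ((p ∈ J ∨ p ∈ N) ∧ p ∉ S))) ∨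
        (p ∈ N ∧ p ∉ J) := by
      simp only [hW, Finset.mem_union, Finset.mem_sdiff, mem_natural]
    simp only [e3, Finset.mem_inter, Finset.mem_sdiff, localWeight]
    by_cases hJ : p ∈ J <;> by_cases hN : p ∈ N <;> by_cases hS : p ∈ S <;>
      simp_all
  have hcard : (S \ J).card = (J \ S).card := Finset.card_sdiff_comm h3
  rw [weight, cut_self, Finset.prod_congr rfl fun p _ => hloc p]
  simp only [Finset.prod_mul_distrib, Finset.prod_ite_mem, Finset.univ_inter, Finset.prod_const]
  rw [hcard, lam, prod_zpow_eq hq', xi_eq_prod, mul_assoc, mul_assoc, mul_assoc]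
  congr 3
  · congr 1
    rw [expL, ← hW, ell_eq_sum, ell_eq_sum]
    push_cast
    rw [← Finset.sum_sub_distrib]
    refine Finset.sum_congr rfl fun p _ => ?_
    rw [height_eq]
    ring
  · refine Finset.prod_congr rfl fun r hr => ?_
    rw [height_eq, Int.toNat_sub]
    congr 3
    -- ξ_q counts with ≤ and the height with <; these agree because `r` lies in `J` and hence not in
    -- S \ J.
    refine Finset.filter_congr fun u hu => ?_
    have : u ≠ r := by
      rintro rfl
      exact (Finset.mem_sdiff.1 hu).2 (Finset.mem_sdiff.1 hr).1
    exact ⟨le_of_lt, fun h => lt_of_le_of_ne h this⟩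

/-- If the l-th element of `S` exceeds that of `J`, then just after the latter `J` is ahead of `S`,
so the height is negative there. -/
lemma weight_eq_zero_of_not_indexLE (q : k) {J N S : Finset (Fin n)} (hc : S.card = J.card)
    (h : ¬ IndexLE S J) : weight q n J N S = 0 := by
  have h' : ∃ l, J.orderEmbOfFin hc.symm l < S.orderEmbOfFin rfl l := by
    by_contra hcon
    push Not at hcon
    exact h ⟨hc.symm, hcon⟩
  obtain ⟨l, hl⟩ := h'
  set a := J.orderEmbOfFin hc.symm l with ha
  refine weight_eq_zero_of_height_neg q (c := a.val + 1) a.2 le_rfl ?_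
  have haJ : a ∈ J := Finset.orderEmbOfFin_mem _ _ _
  have e1 : (cut a.val J).card = l := card_filter_lt_orderEmbOfFin J hc.symm l
  have e2 : (cut (a.val + 1) S).card ≤ l := by
    rw [← card_filter_lt_orderEmbOfFin S rfl l]
    refine Finset.card_le_card fun i hi => ?_
    rw [mem_cut] at hi
    refine Finset.mem_filter.2 ⟨hi.1, lt_of_le_of_lt ?_ hl⟩
    rw [Fin.le_def]
    omega
  rw [height, card_cut_succ a J, e1, if_pos haJ]
  push_cast
  omega

lemma natural_self (J N : Finset (Fin n)) : natural J J N = N := by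
  ext p; rw [mem_natural]; tauto

lemma lam_self (q : k) (J N : Finset (Fin n)) : lam q J J N = 1 := by
  simp [lam, expL, ell, xi_eq_prod]

/-- Reordering y_{T♮} x_T to reach x_I y_M exchanges the roles of the sets: `I` is the target in the
pair (T, T♮), and its complementary set there is `M`. -/
lemma mu_eq_lam (q : k) {T I M : Finset (Fin n)} (h1 : I ∩ M ⊆ T) (h2 : T ⊆ I ∪ M) :
    mu q T I M = lam q I T (natural T I M) := by
  have : natural I T (natural T I M) = M := by
    ext p
    have e1 : p ∈ I → p ∈ M → p ∈ T := fun a b => h1 (Finset.mem_inter.2 ⟨a, b⟩)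
    have e2 : p ∈ T → p ∈ I ∨ p ∈ M := fun a => Finset.mem_union.1 (h2 a)
    simp only [mem_natural]
    tauto
  rw [mu, lam, expLNat, expL, this, Finset.union_comm (I \ M)]

end Coefficients

/-! ### Comparison of coefficients and reduction to the stated index sets. -/

section Main

variable {k : Type*} [Field k] {n : ℕ} {q : k}

theorem sum_weight_smul_minor_mul_minor (hq : q ≠ 0) (I J M N : Finset (Fin n)) :
    (∑ S ∈ (J ∪ N).powerset, if S.card = J.card then
      weight q n J N S • (minor q I S * minor q M (natural S J N)) else 0) =
    ∑ T, ∑ T', if I ⊆ T ∪ T' ∧ I.card = T.card ∧ M = natural I T T' then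
      weight q n T T' I • (minor q T' N * minor q T J) else 0 := by
  obtain ⟨W, _, _, x, y, v, φ, h, -, -, hφ⟩ := exists_fock hq (Finset.univ (α := Fin n))
  have hη := h.coact hq
  set ev : Module.End k W →ₗ[k] k := φ I M ∘ₗ LinearMap.applyₗ v with hev
  -- ψ reads off the coefficient of x_I y_M: evaluate the operator factor at the vacuum `v`, then
  -- apply the dual functional φ.
  set ψ : Oq k n q ⊗[k] Module.End k W →ₗ[k] Oq k n q :=
    (TensorProduct.rid k _).toLinearMap ∘ₗ TensorProduct.map LinearMap.id ev with hψ
  have hψt : ∀ a b, ψ (a ⊗ₜ b) = ev b • a := fun a b => by simp [hψ]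
  have hevw : ∀ I' M', ev (word x I' * word y M') = if I = I' ∧ M = M' then 1 else 0 :=
    fun I' M' => hφ I (Finset.subset_univ _) M (Finset.subset_univ _) I' (Finset.subset_univ _) M'
      (Finset.subset_univ _)
  have hxy : ∀ S S', ψ (word (coact q x) S * word (coact q y) S') = minor q I S * minor q M S' := by
    intro S S'
    rw [h.left.word_coact, h.right.word_coact, Finset.sum_mul_sum, map_sum]
    simp only [map_sum, Algebra.TensorProduct.tmul_mul_tmul, hψt, hevw]
    rw [Finset.sum_eq_single I, Finset.sum_eq_single M]
    · simp
    · intro M' _ hM'; simp [Ne.symm hM']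
    · simp
    · intro I' _ hI'; simp [Ne.symm hI']
    · simp
  have hyx : ψ (word (coact q y) N * word (coact q x) J) =
      ∑ T, ∑ T', if I ⊆ T ∪ T' ∧ I.card = T.card ∧ M = natural I T T' then
      weight q n T T' I • (minor q T' N * minor q T J) else 0 := by
    rw [h.left.word_coact, h.right.word_coact, Finset.sum_mul_sum, Finset.sum_comm, map_sum]
    refine Finset.sum_congr rfl fun T _ => ?_
    rw [map_sum]
    refine Finset.sum_congr rfl fun T' _ => ?_
    rw [Algebra.TensorProduct.tmul_mul_tmul, hψt, h.word_mul_word hq, map_sum]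
    have : ∀ S, ev (if S.card = T.card then weight q n T T' S •
        (word x S * word y (natural S T T')) else 0) =
        if I = S then (if I.card = T.card ∧ M = natural I T T' then weight q n T T' I else 0)
          else 0 := by
      intro S
      by_cases hS : I = S
      · subst hS
        by_cases hc : I.card = T.card
        · simp [hc, hevw]
        · simp [hc]
      · split_ifs <;> simp [hevw, hS]
    rw [Finset.sum_congr rfl fun S _ => this S, Finset.sum_ite_eq]
    simp only [Finset.mem_powerset]
    by_cases h1 : I ⊆ T ∪ T' <;> by_cases h2 : I.card = T.card ∧ M = natural I T T' <;>
      simp [h1, h2]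
  rw [← hyx, hη.word_mul_word hq, map_sum]
  refine Finset.sum_congr rfl fun S _ => ?_
  split_ifs
  · rw [map_smul, hxy]
  · rw [map_zero]

lemma sum_weight_left (hq : q ≠ 0) (J N : Finset (Fin n)) {V : Type*} [AddCommGroup V] [Module k V]
    (f : Finset (Fin n) → V) :
    (∑ S ∈ (J ∪ N).powerset, if S.card = J.card then weight q n J N S • f S else 0) =
      q ^ (J ∩ N).card • f J + q ^ (J ∩ N).card • ∑ S ∈ lsInd J N, lam q S J N • f S := by
  have hJ : J ∉ lsInd J N := by simp [lsInd]
  have hsub : insert J (lsInd J N) ⊆ (J ∪ N).powerset :=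
    Finset.insert_subset (Finset.mem_powerset.2 Finset.subset_union_left) (Finset.filter_subset _ _)
  rw [← Finset.sum_subset hsub, Finset.sum_insert hJ, if_pos rfl,
    weight_eq_lam hq Finset.inter_subset_left Finset.subset_union_left rfl, lam_self, mul_one,
    Finset.smul_sum]
  · congr 1
    refine Finset.sum_congr rfl fun S hS => ?_
    simp only [lsInd, Finset.mem_filter, Finset.mem_powerset] at hS
    rw [if_pos hS.2.2.1, weight_eq_lam hq hS.2.1 hS.1 hS.2.2.1, mul_smul]
  · intro S hS hS'
    split_ifs with hc
    swap
    · rfl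
    simp only [lsInd, Finset.mem_insert, Finset.mem_filter, not_or] at hS'
    by_cases h1 : J ∩ N ⊆ S
    · rw [weight_eq_zero_of_not_indexLE q hc fun h => hS'.2 ⟨hS, h1, hc, h, hS'.1⟩, zero_smul]
    · obtain ⟨m, hm, hmS⟩ := Finset.not_subset.1 h1
      rw [Finset.mem_inter] at hm
      rw [weight_eq_zero_of_mem q m.2 hm.1 hm.2 hmS, zero_smul]

lemma sum_weight_right (hq : q ≠ 0) (I M : Finset (Fin n)) {V : Type*} [AddCommGroup V]
    [Module k V] (f : Finset (Fin n) → Finset (Fin n) → V) :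
    (∑ T, ∑ T', if I ⊆ T ∪ T' ∧ I.card = T.card ∧ M = natural I T T' then
      weight q n T T' I • f T' T else 0) =
    q ^ (I ∩ M).card • f M I +
      q ^ (I ∩ M).card • ∑ T ∈ grInd I M, mu q T I M • f (natural T I M) T := by
  -- A nonzero weight forces T ∩ T' ⊆ I; with M = I♮ this determines T' from T, so the double sum
  -- collapses to a sum over `T`.
  have hzero : ∀ T T', I ⊆ T ∪ T' → M = natural I T T' → weight q n T T' I ≠ 0 →
      T' = natural T I M ∧ I ∩ M ⊆ T ∧ T ⊆ I ∪ M := by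
    intro T T' h1 hM hw
    have h2 : ∀ p, p ∈ T → p ∈ T' → p ∈ I := by
      intro p hp hp'
      by_contra hI
      exact hw (weight_eq_zero_of_mem q p.2 hp hp' hI)
    have h1' : ∀ p, p ∈ I → p ∈ T ∨ p ∈ T' := fun p hp => Finset.mem_union.1 (h1 hp)
    have hM' : ∀ p, p ∈ M ↔ _ := fun p => by rw [hM, mem_natural]
    refine ⟨?_, ?_, ?_⟩
    · ext p
      have := h1' p; have := h2 p
      simp only [mem_natural, hM' p]
      tauto
    · intro p
      have := h1' p; have := h2 p
      simp only [Finset.mem_inter, hM' p]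
      tauto
    · intro p
      have := h1' p; have := h2 p
      simp only [Finset.mem_union, hM' p]
      tauto
  have hval : ∀ T, I ∩ M ⊆ T → T ⊆ I ∪ M → I.card = T.card →
      (∑ T', if I ⊆ T ∪ T' ∧ I.card = T.card ∧ M = natural I T T' then
        weight q n T T' I • f T' T else 0) =
        (q ^ (I ∩ M).card * mu q T I M) • f (natural T I M) T := by
    intro T h1 h2 hc
    have e1 : ∀ p, p ∈ I → p ∈ M → p ∈ T := fun p a b => h1 (Finset.mem_inter.2 ⟨a, b⟩)
    have e2 : ∀ p, p ∈ T → p ∈ I ∨ p ∈ M := fun p a => Finset.mem_union.1 (h2 a)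
    have hI : I ⊆ T ∪ natural T I M := by
      intro p
      simp only [Finset.mem_union, mem_natural]
      tauto
    have hM : M = natural I T (natural T I M) := by
      ext p
      have := e1 p; have := e2 p
      simp only [mem_natural]
      tauto
    have hTT : T ∩ natural T I M = I ∩ M := by
      ext p
      have := e1 p; have := e2 p
      simp only [Finset.mem_inter, mem_natural]
      tauto
    rw [Finset.sum_eq_single (natural T I M), if_pos ⟨hI, hc, hM⟩,
      weight_eq_lam hq (by rw [hTT]; exact Finset.inter_subset_left) hI hc, hTT, mu_eq_lam q h1 h2]
    · intro T' _ hT'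
      split_ifs with h
      · by_cases hw : weight q n T T' I = 0
        · rw [hw, zero_smul]
        · exact absurd (hzero T T' h.1 h.2.2 hw).1 hT'
      · rfl
    · simp
  have hI : I ∉ grInd I M := by simp [grInd]
  rw [← Finset.sum_subset (Finset.subset_univ (insert I (grInd I M))), Finset.sum_insert hI,
    hval I Finset.inter_subset_left Finset.subset_union_left rfl,
    mu_eq_lam q Finset.inter_subset_left Finset.subset_union_left, natural_self, lam_self, mul_one,
    Finset.smul_sum]
  · congr 1
    refine Finset.sum_congr rfl fun T hT => ?_
    simp only [grInd, Finset.mem_filter, Finset.mem_powerset] at hT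
    rw [hval T hT.2.1 hT.1 hT.2.2.1.symm, mul_smul]
  · intro T _ hT
    refine Finset.sum_eq_zero fun T' _ => ?_
    split_ifs with h
    · by_cases hw : weight q n T T' I = 0
      · rw [hw, zero_smul]
      · obtain ⟨-, h1, h2⟩ := hzero T T' h.1 h.2.2 hw
        simp only [grInd, Finset.mem_insert, Finset.mem_filter, Finset.mem_powerset, not_or] at hT
        rw [weight_eq_zero_of_not_indexLE q h.2.1 fun hle =>
          hT.2 ⟨h2, h1, h.2.1.symm, hle, hT.1⟩, zero_smul]
    · rfl

end Main

end QMat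

theorem corollary5p4 {k : Type*} [Field k] (n : ℕ) (q : k) (hq : q ≠ 0)
    (I J M N : Finset (Fin n)) (hIJ : I.card = J.card) (hMN : M.card = N.card) :
    q ^ (J ∩ N).card • (QMat.minor q I J * QMat.minor q M N)
      + q ^ (J ∩ N).card • ∑ S ∈ QMat.lsInd J N,
          QMat.lam q S J N • (QMat.minor q I S * QMat.minor q M (QMat.natural S J N))
    = q ^ (I ∩ M).card • (QMat.minor q M N * QMat.minor q I J)
      + q ^ (I ∩ M).card • ∑ T ∈ QMat.grInd I M,
          QMat.mu q T I M • (QMat.minor q (QMat.natural T I M) N * QMat.minor q T J) := by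
  have h := QMat.sum_weight_smul_minor_mul_minor hq I J M N
  rw [QMat.sum_weight_left hq J N fun S =>
      QMat.minor q I S * QMat.minor q M (QMat.natural S J N), QMat.natural_self,
    QMat.sum_weight_right hq I M fun T' T => QMat.minor q T' N * QMat.minor q T J] at h
  exact h
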